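/- **Setting.** All quantum systems are finite-dimensional (and nonzero), $d_X$ is the dimension of the system $X$, and $R$ denotes an arbitrary reference system. A state is a positive semidefinite operator of unit trace; a channel is a completely positive trace-preserving linear map between operator spaces; a subchannel is a completely positive trace-nonincreasing one. Maps act as the identity on systems not mentioned. **Projective mutual information.** For states $\rho,\sigma$ let $D_{\max}(\rho\|\sigma)=\log_2\inf\{\lambda\in\mathbb R:\rho\le\lambda\sigma\}$ (with value $\infty$ if there is no such $\lambda$) and $D_\Omega(\rho\|\sigma)=D_{\max}(\rho\|\sigma)+D_{\max}(\sigma\|\rho)$. For a channel $\mathcal N_{A\to B}$ let $$I_\Omega(\mathcal N)=\sup_{R,\,\rho_{RA}}\ \inf_{\sigma_B}\ D_\Omega\big(\mathcal N_{A\to B}[\rho_{RA}]\,\big\|\,\rho_R\otimes\sigma_B\big)\in[0,\infty],$$ where $\rho_{RA}$ and $\sigma_B$ range over states. **Protocols.** A supermap $\Theta$ transforms linear maps $A\to B$ linearly into linear maps $M\to M'$. It is probabilistic if, also when applied to a part of a larger bipartite map, it sends subchannels to subchannels, and a superchannel if moreover it sends channels to channels. A superchannel $\Theta$ is an NA protocol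 if its equivalent bipartite channel $\bar\Theta_{MB\to AM'}$ is nonsignalling from Alice (holding $M$, $A$) to Bob (holding $B$, $M'$), that is, $\mathrm{Tr}_A\bar\Theta[\rho_M\otimes\sigma_B]=\mathrm{Tr}_A\bar\Theta[\omega_M\otimes\sigma_B]$ for all states $\rho_M,\omega_M,\sigma_B$. A probabilistic supermap $\Theta$ from maps $A\to B$ to maps $M\to M'$, with $d_{M'}=d_M$, is * a *pEA protocol* if there are a state $\gamma_{A'B'}$, a channel $\mathcal E_{MA'\to A}$ and a subchannel $\mathcal D_{BB'\to M'}$ such that $\Theta\{\mathcal N\}[\rho_M]=(\mathcal D\circ\mathcal N\circ\mathcal E)[\rho_M\otimes\gamma_{A'B'}]$ for all $\mathcal N$ and $\rho_M$; * a *pNA protocol* if there are an NA protocol $\Xi$, from maps $A\to B$ to maps $M\to M'X$ with $X$ a classical flag system, $d_X=2$, and a subchannel $\mathcal D_{M'X\to M'}$ such that $\Theta\{\mathcal N\}=\mathcal D\circ\Xi\{\mathcal N\}$ for all $\mathcal N$. **Capacities.** With $\mathcal N'=\Theta\{\mathcal N\}$, the worst-case conditional error probability is $$P_{\rm err}(\Theta;\mathcal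 N)=1-\inf_{R,\,\psi_{RM}}\frac{\mathrm{Tr}\big[\psi_{RM}\,\mathcal N'[\psi_{RM}]\big]}{\mathrm{Tr}\big[\mathcal N'[\psi_{RM}]\big]},$$ the infimum being over all $R$ and all pure states $\psi_{RM}$ (with $M'$ identified with $M$, and $0/0:=0$: a transmission that is never conclusive counts as a failure). The one-shot $\varepsilon$-error quantum capacities $Q^{\varepsilon}_{\rm pEA}(\mathcal N)$ and $Q^{\varepsilon}_{\rm pNA}(\mathcal N)$ are the suprema of $\log_2 d_M$ over all systems $M$ and all pEA, respectively pNA, protocols $\Theta$ with $P_{\rm err}(\Theta;\mathcal N)\le\varepsilon$. **Theorem.** Let $\mathcal N_{A\to B}$ be a quantum channel and let $\varepsilon\in(0,1)$. Then, in $[0,\infty]$, $$\log_2\left\lceil\sqrt{\tfrac{\varepsilon}{1-\varepsilon}\,2^{I_\Omega(\mathcal N)}+1}-1\right\rceil\ \le\ Q^{\varepsilon}_{\rm pEA}(\mathcal N)\ \le\ Q^{\varepsilon}_{\rm pNA}(\mathcal N)\ \le\ \log_2\left\lfloor\sqrt{\tfrac{\varepsilon}{1-\varepsilon}\,2^{I_\Omega(\mathcal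 N)}+1}\right\rfloor,$$ where both bounds are $\infty$ if $I_\Omega(\mathcal N)=\infty$. -/

import Mathlib

open scoped ENNReal Kronecker ComplexOrder

namespace Postselected

noncomputable section

/-! Finite-dimensional quantum systems are represented by finite index types (an orthonormal basis
of the Hilbert space); the composite of the systems `A` and `B` is `A × B`. Reference systems,
memories and message systems are the `n`-dimensional systems `Fin n`. -/

/-- Operators on the system `A`. -/
abbrev Op (A : Type*) := Matrix A A ℂ

/-- Linear maps from operators on `A` to operators on `B`. -/
abbrev SuperOp (A B : Type*) := Op A →ₗ[ℂ] Op B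

/-- Linear transformations of linear maps `A → B` into linear maps `C → D`. -/
abbrev Supermap (A B C D : Type*) := SuperOp A B →ₗ[ℂ] SuperOp C D

section Basic

variable {A B C D K : Type*}

/-- A quantum state: positive semidefinite with unit trace. -/
def IsState [Fintype A] (ρ : Op A) : Prop := ρ.PosSemidef ∧ ρ.trace = 1

/-- A pure state `|v⟩⟨v|`, with `v` a unit vector. -/
def IsPureState [Fintype A] (ψ : Op A) : Prop :=
  ∃ v : A → ℂ, star v ⬝ᵥ v = 1 ∧ ψ = Matrix.vecMulVec v (star v)

/-- The block `⟨k| X |l⟩` of an operator on `K ⊗ A`, as a linear function of `X`. -/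
def block (k l : K) : SuperOp (K × A) A where
  toFun X := Matrix.of fun a a' => X (k, a) (l, a')
  map_add' _ _ := rfl
  map_smul' _ _ := rfl

/-- The operator `|k⟩⟨l| ⊗ Y` on `K ⊗ A`, as a linear function of `Y`. -/
def inject [DecidableEq K] (k l : K) : SuperOp A (K × A) where
  toFun Y := Matrix.single k l (1 : ℂ) ⊗ₖ Y
  map_add' X Y := Matrix.kronecker_add _ X Y
  map_smul' c X := Matrix.kronecker_smul c _ X

/-- `id_K ⊗ N`, for a linear map `N : A → B` and a reference system `K`. -/
def ampl (K : Type*) (N : SuperOp A B) : SuperOp (K × A) (K × B) where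
  toFun X := Matrix.of fun p q => N (block p.1 q.1 X) p.2 q.2
  map_add' X Y := by
    ext p q
    simp [map_add]
  map_smul' c X := by
    ext p q
    simp [map_smul]

/-- The partial trace over the left tensor factor. -/
def traceLeft [Fintype K] (X : Op (K × A)) : Op A :=
  Matrix.of fun a a' => ∑ k, X (k, a) (k, a')

/-- The partial trace over the right tensor factor. -/
def traceRight [Fintype A] (X : Op (K × A)) : Op K :=
  Matrix.of fun k k' => ∑ a, X (k, a) (k', a)

end Basic

section Channels

variable {A B : Type*} [Fintype A] [Fintype B]

/-- Complete positivity. -/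
def IsCP (N : SuperOp A B) : Prop :=
  ∀ (r : ℕ) (X : Op (Fin r × A)), X.PosSemidef → (ampl (Fin r) N X).PosSemidef

/-- A quantum channel: completely positive and trace preserving. -/
def IsChannel (N : SuperOp A B) : Prop :=
  IsCP N ∧ ∀ X : Op A, (N X).trace = X.trace

/-- A subchannel: completely positive and trace nonincreasing. -/
def IsSubchannel (N : SuperOp A B) : Prop :=
  IsCP N ∧ ∀ X : Op A, X.PosSemidef → (N X).trace.re ≤ X.trace.re

end Channels

section Information

/-- The binary logarithm `[0, ∞] → [-∞, ∞]`, with `log₂ 0 = -∞` and `log₂ ∞ = ∞`. -/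
def log2 (x : ℝ≥0∞) : EReal := ENNReal.log x / ((Real.log 2 : ℝ) : EReal)

/-- The map `x ↦ 2 ^ x` from `[-∞, ∞]` to `[0, ∞]`, with `2 ^ (-∞) = 0` and `2 ^ ∞ = ∞`. -/
def twoPow (x : EReal) : ℝ≥0∞ := EReal.exp (x * ((Real.log 2 : ℝ) : EReal))

variable {A B : Type*} [Fintype A] [Fintype B]

/-- The max-relative entropy `log₂ inf {l ∈ ℝ : ρ ≤ l σ}` of two states. -/
def dMax (ρ σ : Op A) : EReal :=
  log2 (⨅ (l : ℝ) (_ : ((l : ℂ) • σ - ρ).PosSemidef), ENNReal.ofReal l)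

/-- The Hilbert projective metric. -/
def dOmega (ρ σ : Op A) : EReal := dMax ρ σ + dMax σ ρ

/-- The projective mutual information `inf_{σ_B} D_Ω(ρ_{AB} ‖ ρ_A ⊗ σ_B)` of a bipartite state. -/
def projMutualInfo (ρ : Op (A × B)) : EReal :=
  ⨅ (σ : Op B) (_ : IsState σ), dOmega ρ (traceRight ρ ⊗ₖ σ)

/-- The projective mutual information of a channel: the supremum over all reference systems `R` and
all states `ρ_{RA}` of the projective mutual information of the output state on `R ⊗ B`. -/
def channelProjMutualInfo (N : SuperOp A B) : EReal :=
  ⨆ (r : ℕ) (ρ : Op (Fin r × A)) (_ : IsState ρ), projMutualInfo (ampl (Fin r) N ρ)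

end Information

section Supermaps

variable {A B C D : Type*}

/-- `1 ⊗ Θ`, transforming maps `R ⊗ A → R' ⊗ B` into maps `R ⊗ C → R' ⊗ D`: a map `N` is a sum of
maps `(|r⟩⟨s| ↦ |r'⟩⟨s'|) ⊗ N'`, and `Θ` is applied to the components `N'`. -/
def extend (R R' : Type*) [Fintype R] [DecidableEq R] (Θ : Supermap A B C D)
    (N : SuperOp (R × A) (R' × B)) : SuperOp (R × C) (R' × D) where
  toFun X := Matrix.of fun p q => ∑ r, ∑ s,
    Θ (block p.1 q.1 ∘ₗ N ∘ₗ inject r s) (block r s X) p.2 q.2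
  map_add' X Y := by
    ext p q
    simp [map_add, Finset.sum_add_distrib]
  map_smul' c X := by
    ext p q
    simp [map_smul, Finset.mul_sum]

/-- The map `Y ↦ ⟨a| Y |a'⟩ |b⟩⟨b'|`. -/
def elemMap [DecidableEq B] (a a' : A) (b b' : B) : SuperOp A B :=
  (Matrix.entryLinearMap ℂ ℂ a a').smulRight (Matrix.single b b' 1)

/-- The bipartite map `C ⊗ B → A ⊗ D` equivalent to a supermap: it sends `ρ ⊗ |b⟩⟨b'|` to
`∑ a a', |a⟩⟨a'| ⊗ Θ{Y ↦ ⟨a| Y |a'⟩ |b⟩⟨b'|}[ρ]`. If `Θ` consists of a preprocessing `C → A ⊗ E`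
and a postprocessing `B ⊗ E → D`, this is the postprocessing after the preprocessing, with the
slot between `A` and `B` left open. -/
def bipartite [Fintype B] [DecidableEq B] (Θ : Supermap A B C D) : SuperOp (C × B) (A × D) where
  toFun X := Matrix.of fun p q => ∑ b, ∑ b',
    Θ (elemMap p.1 q.1 b b') (X.submatrix (fun c => (c, b)) (fun c => (c, b'))) p.2 q.2
  map_add' X Y := by
    ext p q
    simp [Matrix.submatrix_add, map_add, Finset.sum_add_distrib]
  map_smul' c X := by
    ext p q
    simp [Matrix.submatrix_smul, map_smul, Finset.mul_sum]

variable [Fintype A] [Fintype B] [Fintype C] [Fintype D]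

/-- A probabilistic supermap: linear, and it transforms subchannels into subchannels, also when
applied to a part of a larger bipartite subchannel. -/
def IsProbSupermap (Θ : Supermap A B C D) : Prop :=
  ∀ (r r' : ℕ) (N : SuperOp (Fin r × A) (Fin r' × B)),
    IsSubchannel N → IsSubchannel (extend (Fin r) (Fin r') Θ N)

/-- A (deterministic) superchannel: a probabilistic supermap that transforms channels into
channels. -/
def IsSuperchannel (Θ : Supermap A B C D) : Prop :=
  IsProbSupermap Θ ∧ ∀ N : SuperOp A B, IsChannel N → IsChannel (Θ N)

/-- A nonsignalling-assisted protocol: a superchannel whose bipartite map is Alice-to-Bob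
nonsignalling, `A` being Alice's output and `D` being Bob's output. -/
def IsNA [DecidableEq B] (Θ : Supermap A B C D) : Prop :=
  IsSuperchannel Θ ∧
    ∀ (ρ ω : Op C) (σ : Op B), IsState ρ → IsState ω → IsState σ →
      traceLeft (bipartite Θ (ρ ⊗ₖ σ)) = traceLeft (bipartite Θ (ω ⊗ₖ σ))

/-- A postselected entanglement-assisted protocol `(γ, E, D)`: a shared state `γ` on `B' ⊗ A'`, an
encoding channel `E : A' ⊗ M → A` and a decoding subchannel `D : B' ⊗ B → M'`. -/
def IsPEA {M M' : Type*} [Fintype M] [Fintype M'] (Θ : Supermap A B M M') : Prop :=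
  IsProbSupermap Θ ∧
    ∃ (a' b' : ℕ) (γ : Op (Fin b' × Fin a')) (E : SuperOp (Fin a' × M) A)
      (D : SuperOp (Fin b' × B) M'),
      IsState γ ∧ IsChannel E ∧ IsSubchannel D ∧
        ∀ (N : SuperOp A B) (ρ : Op M),
          Θ N ρ = D (ampl (Fin b') N (ampl (Fin b') E
            (Matrix.reindex (Equiv.prodAssoc _ _ _) (Equiv.prodAssoc _ _ _) (γ ⊗ₖ ρ))))

/-- A postselected nonsignalling-assisted protocol: a nonsignalling-assisted protocol `Ξ` whose
output consists of `M'` and of a classical flag system `X` of size two, followed by a subchannel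
`D : M' ⊗ X → M'`. That the flag is classical means that the output of `Ξ` is block diagonal
in `X`. -/
def IsPNA {M M' : Type*} [Fintype M] [Fintype M'] [DecidableEq B]
    (Θ : Supermap A B M M') : Prop :=
  IsProbSupermap Θ ∧
    ∃ (Ξ : Supermap A B M (M' × Fin 2)) (D : SuperOp (M' × Fin 2) M'),
      IsNA Ξ ∧
      (∀ (N : SuperOp A B) (ρ : Op M) (m m' : M') (x x' : Fin 2), x ≠ x' →
        Ξ N ρ (m, x) (m', x') = 0) ∧
      IsSubchannel D ∧
      ∀ (N : SuperOp A B) (ρ : Op M), Θ N ρ = D (Ξ N ρ)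

end Supermaps

section Capacity

/-- `Tr[ψ_{RM} N'(ψ_{RM})] / Tr[N'(ψ_{RM})]`, the fidelity conditioned on a conclusive outcome. If
the outcome is never conclusive, the division by zero gives `0`: this counts as a failure. -/
def condFidelity {M R : Type*} [Fintype M] [Fintype R] (N' : SuperOp M M) (ψ : Op (R × M)) : ℝ :=
  (ψ * ampl R N' ψ).trace.re / (ampl R N' ψ).trace.re

/-- The worst-case conditional error probability of quantum communication when the subchannel `N'`
is simulated: one minus the infimum of the conditional fidelity over all reference systems `R` and
all pure states of `R ⊗ M`. -/
def quantumError {M : Type*} [Fintype M] (N' : SuperOp M M) : ℝ :=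
  1 - sInf {f : ℝ | ∃ (r : ℕ) (ψ : Op (Fin r × M)), IsPureState ψ ∧ f = condFidelity N' ψ}

variable {A B : Type*}

/-- The one-shot `ε`-error quantum capacity assisted by the class `T` of supermaps (`T d` consists
of the available supermaps whose message system has dimension `d`). -/
def quantumCapacity (T : ∀ d : ℕ, Set (Supermap A B (Fin d) (Fin d))) (ε : ℝ)
    (N : SuperOp A B) : EReal :=
  ⨆ (d : ℕ) (_ : 0 < d) (Θ : Supermap A B (Fin d) (Fin d)) (_ : Θ ∈ T d)
    (_ : quantumError (Θ N) ≤ ε), log2 (d : ℝ≥0∞)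

variable [Fintype A] [Fintype B]

/-- The one-shot `ε`-error quantum capacity with postselected entanglement assistance. -/
def qPEA (ε : ℝ) (N : SuperOp A B) : EReal :=
  quantumCapacity (fun _ => {Θ | IsPEA Θ}) ε N

/-- The one-shot `ε`-error quantum capacity with postselected nonsignalling assistance. -/
def qPNA [DecidableEq B] (ε : ℝ) (N : SuperOp A B) : EReal :=
  quantumCapacity (fun _ => {Θ | IsPNA Θ}) ε N

/-- The quantity `√(ε / (1 - ε) · 2 ^ I_Ω(N) + 1)`, with value in `[0, ∞]`. -/
def capacityRoot (ε : ℝ) (N : SuperOp A B) : ℝ≥0∞ :=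
  (ENNReal.ofReal (ε / (1 - ε)) * twoPow (channelProjMutualInfo N) + 1) ^ (1 / 2 : ℝ)

end Capacity

end

end Postselected

/-! Write `J = choi N` and `κ = ε / (1 - ε)`. The number `2 ^ I_Ω(N)` is the infimum of the ratios
`μ` for which some `σ` satisfies `σ ⊗ 1 ≤ J ≤ μ (σ ⊗ 1)`, that is, for which `N` lies, in the
completely positive order, between two multiples of a replacer map `Y ↦ Tr[Y] σ` with ratio `μ`. A
maximally entangled input turns bounds on states into bounds on maps (`exists_dominating`), and
bounds on maps pass to every input (`channelProjMutualInfo_le`). Both capacity bounds compare `d² -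
1` with `κ μ`.

Converse (`sq_sub_one_le`): nonsignalling forces a protocol to send a replacer to a replacer, since
Bob learns nothing through a channel with constant output. Probabilistic supermaps preserve the
completely positive order, so the simulated map is again sandwiched around a replacer. On a
maximally entangled input `Φ`, the output of that replacer has weight exactly `1 / d²` on `Φ`.
Testing one inequality with `Φ` and the other with `1 - Φ` bounds the odds of success, and gives `d²
- 1 ≤ κ l₁ l₂`.

Achievability: if no sandwich with ratio `μ` exists, separation from a closed convex cone
(`exists_dual`) yields `X, Y ≥ 0` with `Tr_A X = μ Tr_A Y` and `⟨X, J⟩ < ⟨Y, J⟩`. Rescaled, these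
are Choi operators of two channels from `B` to `A`. Alice compares the message with her half of an
entangled pair, as in teleportation, and applies one channel or the other to a further entangled
half according to the outcome. Bob's postselection closes the loop through `N`, which weights her
outcomes by the two pairings with `J` (`exists_isPEA`). The bias towards the good outcome makes the
conditional error at most `ε` (`quantumError_le`).

The middle inequality holds because shared entanglement is nonsignalling and a decoding subchannel
is a channel with a discarded failure flag (`IsPEA.isPNA`). -/

namespace Postselected

set_option linter.unusedSectionVars false

/-! ### Positive semidefinite matrices. -/

section Posdef

variable {n : Type*} [Fintype n]

theorem exists_eq_conjTranspose_mul_self {P : Op n} (hP : P.PosSemidef) :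
    ∃ C : Op n, P = C.conjTranspose * C := by
  classical
  open scoped MatrixOrder in
  obtain ⟨C, hC⟩ := CStarAlgebra.nonneg_iff_eq_star_mul_self.mp hP.nonneg
  exact ⟨C, hC⟩

theorem norm_entry_le_trace {P : Op n} (hP : P.PosSemidef) (i j : n) :
    ‖P i j‖ ≤ P.trace.re := by
  classical
  obtain ⟨C, rfl⟩ := exists_eq_conjTranspose_mul_self hP
  have hdiag : ∀ i, ((C.conjTranspose * C) i i).re = ∑ k, ‖C k i‖ ^ 2 := by
    intro i
    simp [Matrix.mul_apply, Complex.sq_norm, Complex.normSq_apply]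
  have htr : (C.conjTranspose * C).trace.re = ∑ i, ∑ k, ‖C k i‖ ^ 2 := by
    simp only [Matrix.trace, Matrix.diag, Complex.re_sum, hdiag]
  have hle : ∀ i, ∑ k, ‖C k i‖ ^ 2 ≤ ∑ i, ∑ k, ‖C k i‖ ^ 2 := fun i =>
    Finset.single_le_sum (f := fun i => ∑ k, ‖C k i‖ ^ 2)
      (fun i _ => Finset.sum_nonneg fun k _ => by positivity) (Finset.mem_univ i)
  rw [htr]
  calc ‖(C.conjTranspose * C) i j‖ ≤ ∑ k, ‖C k i‖ * ‖C k j‖ := by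
        rw [Matrix.mul_apply]
        refine (norm_sum_le _ _).trans (le_of_eq ?_)
        simp
    _ ≤ ∑ k, (‖C k i‖ ^ 2 / 2 + ‖C k j‖ ^ 2 / 2) :=
        Finset.sum_le_sum fun k _ => by nlinarith [sq_nonneg (‖C k i‖ - ‖C k j‖)]
    _ = (∑ k, ‖C k i‖ ^ 2) / 2 + (∑ k, ‖C k j‖ ^ 2) / 2 := by
        rw [Finset.sum_add_distrib, Finset.sum_div, Finset.sum_div]
    _ ≤ _ := by linarith [hle i, hle j]

theorem trace_eq_ofReal {P : Op n} (hP : P.PosSemidef) : P.trace = (P.trace.re : ℂ) :=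
  (Complex.eq_re_of_ofReal_le (r := 0) (by simpa using hP.trace_nonneg))

theorem trace_re_nonneg {P : Op n} (hP : P.PosSemidef) : 0 ≤ P.trace.re :=
  (Complex.le_def.1 hP.trace_nonneg).1

theorem trace_mul_nonneg {P Q : Op n} (hP : P.PosSemidef) (hQ : Q.PosSemidef) :
    0 ≤ (P * Q).trace := by
  obtain ⟨C, rfl⟩ := exists_eq_conjTranspose_mul_self hQ
  rw [← mul_assoc, Matrix.trace_mul_comm, ← mul_assoc]
  exact (hP.mul_mul_conjTranspose_same C).trace_nonneg

theorem PosSemidef.real_smul {P : Op n} (hP : P.PosSemidef) {c : ℝ} (hc : 0 ≤ c) :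
    ((c : ℂ) • P).PosSemidef :=
  hP.smul (by exact_mod_cast hc)

end Posdef

/-! ### Completely positive maps and Choi operators. -/

section CompletelyPositive

variable {A B C D K K' : Type*}

theorem block_apply (k l : K) (X : Op (K × A)) (a a' : A) :
    block k l X a a' = X (k, a) (l, a') := rfl

theorem ampl_apply (N : SuperOp A B) (X : Op (K × A)) (p q : K × B) :
    ampl K N X p q = N (block p.1 q.1 X) p.2 q.2 := rfl

theorem inject_apply [DecidableEq K] (k l : K) (Y : Op A) (p q : K × A) :
    inject k l Y p q = Matrix.single k l 1 p.1 q.1 * Y p.2 q.2 := rfl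

theorem submatrix_ampl (N : SuperOp A B) (e : K' → K) (X : Op (K × A)) :
    (ampl K N X).submatrix (Prod.map e id) (Prod.map e id) =
      ampl K' N (X.submatrix (Prod.map e id) (Prod.map e id)) := rfl

variable [Fintype A] [Fintype B] [Fintype C] [Fintype D] [Fintype K] [Fintype K']

theorem IsCP.ampl_posSemidef {N : SuperOp A B} (hN : IsCP N) {X : Op (K × A)}
    (hX : X.PosSemidef) : (ampl K N X).PosSemidef := by
  classical
  let e := Fintype.equivFin K
  have h := (hN _ _ (hX.submatrix (Prod.map e.symm id))).submatrix (Prod.map e id)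
  rw [← submatrix_ampl, Matrix.submatrix_submatrix, Prod.map_comp_map] at h
  simpa using h

theorem IsCP.posSemidef {N : SuperOp A B} (hN : IsCP N) {X : Op A} (hX : X.PosSemidef) :
    (N X).PosSemidef :=
  (hN 1 (X.submatrix Prod.snd Prod.snd) (hX.submatrix _)).submatrix (fun b => ((0 : Fin 1), b))

theorem IsCP.comp {M : SuperOp B C} {N : SuperOp A B} (hM : IsCP M) (hN : IsCP N) :
    IsCP (M ∘ₗ N) := fun r X hX => hM r _ (hN r X hX)

theorem IsCP.add {M N : SuperOp A B} (hM : IsCP M) (hN : IsCP N) : IsCP (M + N) :=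
  fun r X hX => (hM r X hX).add (hN r X hX)

theorem ampl_smul (c : ℂ) (N : SuperOp A B) : ampl K (c • N) = c • ampl K N := rfl

theorem IsCP.smul {N : SuperOp A B} (hN : IsCP N) {c : ℝ} (hc : 0 ≤ c) : IsCP ((c : ℂ) • N) :=
  fun r X hX => PosSemidef.real_smul (hN r X hX) hc

/-- The amplification of an amplification is an amplification, up to associativity. -/
theorem IsCP.ampl {N : SuperOp A B} (hN : IsCP N) : IsCP (ampl K N) := by
  intro r X hX
  exact (hN.ampl_posSemidef (K := Fin r × K)
    (hX.submatrix (Equiv.prodAssoc (Fin r) K A))).submatrix (Equiv.prodAssoc (Fin r) K B).symm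

/-- Conjugation `X ↦ S X Sᴴ`. -/
noncomputable def conjMap (S : Matrix B A ℂ) : SuperOp A B where
  toFun X := S * X * S.conjTranspose
  map_add' X Y := by rw [Matrix.mul_add, Matrix.add_mul]
  map_smul' c X := by simp

theorem conjMap_apply (S : Matrix B A ℂ) (X : Op A) :
    conjMap S X = S * X * S.conjTranspose := rfl

theorem isCP_conjMap (S : Matrix B A ℂ) : IsCP (conjMap S) := by
  classical
  intro r X hX
  have h := hX.mul_mul_conjTranspose_same ((1 : Op (Fin r)) ⊗ₖ S)
  convert h using 1
  ext ⟨k, b⟩ ⟨l, b'⟩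
  simp only [ampl_apply, conjMap_apply, Matrix.mul_apply, Fintype.sum_prod_type, block_apply,
    Matrix.one_apply, Matrix.kroneckerMap_apply, Matrix.conjTranspose_apply, ite_mul, one_mul,
    zero_mul, Finset.sum_ite_irrel, Finset.sum_const_zero, Finset.sum_ite_eq, Finset.mem_univ,
    if_true, apply_ite star, star_zero, mul_ite, mul_zero]

theorem IsCP.sum {ι : Type*} (s : Finset ι) {N : ι → SuperOp A B} (h : ∀ i ∈ s, IsCP (N i)) :
    IsCP (∑ i ∈ s, N i) := by
  intro r X hX
  have : Postselected.ampl (Fin r) (∑ i ∈ s, N i) X =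
      ∑ i ∈ s, Postselected.ampl (Fin r) (N i) X := by
    ext p q
    simp [Postselected.ampl, Matrix.sum_apply]
  rw [this]
  exact Matrix.posSemidef_sum s fun i hi => h i hi r X hX

/-- The Choi operator of a linear map. -/
def choi [DecidableEq A] (N : SuperOp A B) : Op (B × A) :=
  Matrix.of fun p q => N (Matrix.single p.2 q.2 1) p.1 q.1

theorem apply_eq_sum_choi [DecidableEq A] (N : SuperOp A B) (X : Op A) (b b' : B) :
    N X b b' = ∑ a, ∑ a', X a a' * choi N (b, a) (b', a') := by
  conv_lhs => rw [Matrix.matrix_eq_sum_single X]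
  have : ∀ a a', Matrix.single a a' (X a a') = X a a' • Matrix.single a a' (1 : ℂ) := by simp
  simp [this, Matrix.sum_apply, choi, -Matrix.smul_single]

theorem IsCP.choi_posSemidef [DecidableEq A] {N : SuperOp A B} (hN : IsCP N) :
    (choi N).PosSemidef := by
  let v : A × A → ℂ := fun p => if p.1 = p.2 then 1 else 0
  have h := (hN.ampl_posSemidef (K := A) (Matrix.posSemidef_vecMulVec_self_star v)).submatrix
    (Prod.swap : B × A → A × B)
  convert h using 1
  ext ⟨b, a⟩ ⟨b', a'⟩
  have : Matrix.single a a' (1 : ℂ) = block a a' (Matrix.vecMulVec v (star v)) := by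
    ext i j
    by_cases h1 : a = i <;> by_cases h2 : a' = j <;>
      simp [block_apply, v, Matrix.vecMulVec_apply, h1, h2]
  simp [choi, Postselected.ampl, this]

/-- A factorization of the Choi operator as `Cᴴ C` is a Kraus decomposition: each row of `C`,
conjugated and reshaped, is a Kraus operator. -/
theorem isCP_of_choi [DecidableEq A] {N : SuperOp A B} (hN : (choi N).PosSemidef) : IsCP N := by
  classical
  obtain ⟨C, hC⟩ := exists_eq_conjTranspose_mul_self hN
  have : N = ∑ k, conjMap (Matrix.of fun b a => star (C k (b, a))) := by
    ext X b b'
    refine (apply_eq_sum_choi N X b b').trans ?_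
    simp only [hC, conjMap, Matrix.mul_apply, LinearMap.coe_sum, Finset.sum_apply,
      Matrix.sum_apply, LinearMap.coe_mk, AddHom.coe_mk, Matrix.conjTranspose_apply,
      Matrix.of_apply, star_star, Finset.mul_sum, Finset.sum_mul]
    rw [Finset.sum_comm]
    conv_rhs => rw [Finset.sum_comm]
    refine Finset.sum_congr rfl fun a _ => ?_
    conv_rhs => rw [Finset.sum_comm]
    refine Finset.sum_congr rfl fun a' _ => ?_
    refine Finset.sum_congr rfl fun k _ => ?_
    ring
  rw [this]
  exact IsCP.sum _ fun k _ => isCP_conjMap _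

/-- Reindexing as a linear map between operator spaces. -/
def reindexMap (e : B → A) : SuperOp A B where
  toFun X := X.submatrix e e
  map_add' _ _ := rfl
  map_smul' _ _ := rfl

theorem reindexMap_apply (e : B → A) (X : Op A) (b b' : B) :
    reindexMap e X b b' = X (e b) (e b') := rfl

theorem isCP_reindexMap (e : B → A) : IsCP (reindexMap e) := fun _ _ hX =>
  hX.submatrix (Prod.map id e)

theorem trace_reindexMap (e : B ≃ A) (X : Op A) : (reindexMap e X).trace = X.trace := by
  exact e.sum_comp fun a => X a a

theorem isChannel_reindexMap (e : B ≃ A) : IsChannel (reindexMap e) :=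
  ⟨isCP_reindexMap e, trace_reindexMap e⟩

theorem IsChannel.isSubchannel {N : SuperOp A B} (hN : IsChannel N) : IsSubchannel N :=
  ⟨hN.1, fun X _ => by rw [hN.2]⟩

theorem IsChannel.comp {M : SuperOp B C} {N : SuperOp A B} (hM : IsChannel M)
    (hN : IsChannel N) : IsChannel (M ∘ₗ N) :=
  ⟨hM.1.comp hN.1, fun X => by simp [hM.2, hN.2]⟩

theorem IsSubchannel.comp {M : SuperOp B C} {N : SuperOp A B} (hM : IsSubchannel M)
    (hN : IsSubchannel N) : IsSubchannel (M ∘ₗ N) :=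
  ⟨hM.1.comp hN.1, fun X hX => (hM.2 _ (hN.1.posSemidef hX)).trans (hN.2 X hX)⟩

theorem trace_eq_sum_block (X : Op (K × A)) : X.trace = ∑ k, (block k k X).trace := by
  simp [Matrix.trace, block_apply, Fintype.sum_prod_type]

theorem trace_ampl (N : SuperOp A B) (X : Op (K × A)) :
    (ampl K N X).trace = ∑ k, (N (block k k X)).trace := by
  rw [trace_eq_sum_block]; rfl

theorem block_posSemidef {X : Op (K × A)} (hX : X.PosSemidef) (k : K) :
    (block k k X).PosSemidef := hX.submatrix (fun a => (k, a))

theorem IsChannel.ampl {N : SuperOp A B} (hN : IsChannel N) : IsChannel (ampl K N) :=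
  ⟨hN.1.ampl, fun X => by simp [trace_ampl, hN.2, trace_eq_sum_block X]⟩

theorem IsSubchannel.ampl {N : SuperOp A B} (hN : IsSubchannel N) : IsSubchannel (ampl K N) :=
  ⟨hN.1.ampl, fun X hX => by
    simp only [trace_ampl, trace_eq_sum_block X, Complex.re_sum]
    exact Finset.sum_le_sum fun k _ => hN.2 _ (block_posSemidef hX k)⟩

/-- The entries of a positive operator are bounded by its trace, hence so is the output trace, up to
a constant. This gives access to supermaps, which are controlled only on subchannels. -/
theorem IsCP.exists_isSubchannel_smul {N : SuperOp A B} (hN : IsCP N) :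
    ∃ c : ℝ, 0 < c ∧ IsSubchannel ((c : ℂ) • N) := by
  classical
  set S : ℝ := ∑ a, ∑ a', ‖(N (Matrix.single a a' 1)).trace‖ with hS
  have hS0 : 0 ≤ S := Finset.sum_nonneg fun _ _ => Finset.sum_nonneg fun _ _ => norm_nonneg _
  refine ⟨(S + 1)⁻¹, by positivity, hN.smul (by positivity), fun X hX => ?_⟩
  have htr : (N X).trace = ∑ a, ∑ a', X a a' * (N (Matrix.single a a' 1)).trace := by
    conv_lhs => rw [Matrix.matrix_eq_sum_single X]
    have : ∀ a a', Matrix.single a a' (X a a') = X a a' • Matrix.single a a' (1 : ℂ) := by simp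
    simp [this, Matrix.trace_sum, -Matrix.smul_single]
  have hle : (N X).trace.re ≤ X.trace.re * S := by
    refine (Complex.re_le_norm _).trans ?_
    rw [htr, hS, Finset.mul_sum]
    refine (norm_sum_le _ _).trans (Finset.sum_le_sum fun a _ => ?_)
    rw [Finset.mul_sum]
    refine (norm_sum_le _ _).trans (Finset.sum_le_sum fun a' _ => ?_)
    rw [norm_mul]
    exact mul_le_mul_of_nonneg_right (norm_entry_le_trace hX a a') (norm_nonneg _)
  have h0 := trace_re_nonneg hX
  have : (((((S + 1)⁻¹ : ℝ) : ℂ) • N) X).trace.re = (S + 1)⁻¹ * (N X).trace.re := by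
    simp only [LinearMap.smul_apply, Matrix.trace_smul, smul_eq_mul, Complex.re_ofReal_mul]
  rw [this, inv_mul_le_iff₀ (by positivity)]
  nlinarith

/-- The map `Y ↦ Tr[Y] σ`. -/
noncomputable def replacer (A : Type*) [Fintype A] (σ : Op B) : SuperOp A B :=
  (Matrix.traceLinearMap A ℂ ℂ).smulRight σ

theorem replacer_apply (σ : Op B) (X : Op A) : replacer A σ X = X.trace • σ := rfl

theorem ampl_replacer (σ : Op B) (X : Op (K × A)) :
    ampl K (replacer A σ) X = traceRight X ⊗ₖ σ := by
  ext p q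
  simp [ampl_apply, replacer_apply, traceRight, Matrix.trace, block_apply, Matrix.kroneckerMap_apply]

theorem choi_replacer [DecidableEq A] (σ : Op B) :
    choi (replacer A σ) = σ ⊗ₖ (1 : Op A) := by
  ext p q
  by_cases h : p.2 = q.2
  · simp [choi, replacer_apply, Matrix.kroneckerMap_apply, h, Matrix.one_apply]
  · simp [choi, replacer_apply, Matrix.kroneckerMap_apply, h, Matrix.trace_single_eq_of_ne]

end CompletelyPositive

/-! ### Supermaps made of preprocessing and postprocessing. -/

section Comb

variable {A B C D K R R' : Type*} [Fintype A] [Fintype B] [Fintype C] [Fintype D] [Fintype K]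

/-- Preprocessing with memory `K`, followed by postprocessing. -/
def comb (post : SuperOp (K × B) D) (pre : SuperOp C (K × A)) : Supermap A B C D where
  toFun N := post ∘ₗ ampl K N ∘ₗ pre
  map_add' M N := by
    have : ampl K (M + N) = ampl K M + ampl K N := rfl
    rw [this, LinearMap.add_comp, LinearMap.comp_add]
  map_smul' c N := by
    rw [ampl_smul, LinearMap.smul_comp, LinearMap.comp_smul]; rfl

theorem comb_apply (post : SuperOp (K × B) D) (pre : SuperOp C (K × A)) (N : SuperOp A B)
    (ρ : Op C) : comb post pre N ρ = post (ampl K N (pre ρ)) := rfl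

/-- Exchange of the first two of three systems. -/
def prodLeftComm (K R A : Type*) : K × (R × A) ≃ R × (K × A) where
  toFun p := (p.2.1, p.1, p.2.2)
  invFun p := (p.2.1, p.1, p.2.2)
  left_inv _ := rfl
  right_inv _ := rfl

theorem sum_inject_block [Fintype R] [DecidableEq R] (X : Op (R × A)) :
    ∑ r, ∑ s, inject r s (block r s X) = X := by
  ext p q
  simp [Matrix.sum_apply, inject_apply, block_apply, Matrix.single_apply, ite_and]

theorem block_ampl (N : SuperOp A B) (k l : K) (X : Op (K × A)) :
    block k l (ampl K N X) = N (block k l X) := rfl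

/-- The componentwise definition of `extend` collapses to an actual circuit: the memory `K` becomes
one more reference of `N`, after reordering systems. Complete positivity and trace bounds can then
be read off by composition. -/
theorem extend_comb [Fintype R] [DecidableEq R] (post : SuperOp (K × B) D)
    (pre : SuperOp C (K × A)) (N : SuperOp (R × A) (R' × B)) :
    extend R R' (comb post pre) N = ampl R' post ∘ₗ reindexMap (prodLeftComm R' K B) ∘ₗ
      ampl K N ∘ₗ reindexMap (prodLeftComm K R A) ∘ₗ ampl R pre := by
  ext X p q
  have key : ∑ r, ∑ s, ampl K (block p.1 q.1 ∘ₗ N ∘ₗ inject r s) (pre (block r s X)) =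
      block p.1 q.1 (reindexMap (prodLeftComm R' K B)
        (ampl K N (reindexMap (prodLeftComm K R A) (ampl R pre X)))) := by
    ext ⟨k, b⟩ ⟨l, b'⟩
    have h : block k l (reindexMap (prodLeftComm K R A) (ampl R pre X)) =
        ∑ r, ∑ s, inject r s (block k l (pre (block r s X))) := by
      rw [← sum_inject_block (block k l (reindexMap (prodLeftComm K R A) (ampl R pre X)))]
      rfl
    have h2 : block p.1 q.1 (reindexMap (prodLeftComm R' K B)
        (ampl K N (reindexMap (prodLeftComm K R A) (ampl R pre X)))) (k, b) (l, b') =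
        N (block k l (reindexMap (prodLeftComm K R A) (ampl R pre X))) (p.1, b) (q.1, b') := rfl
    rw [h2, h]
    simp [Matrix.sum_apply, ampl_apply, block_apply]
  have : extend R R' (comb post pre) N X p q =
      ∑ r, ∑ s, post (ampl K (block p.1 q.1 ∘ₗ N ∘ₗ inject r s) (pre (block r s X))) p.2 q.2 :=
    rfl
  simp only [LinearMap.comp_apply]
  rw [this, ampl_apply, ← key]
  simp [Matrix.sum_apply]

theorem isProbSupermap_comb {post : SuperOp (K × B) D} {pre : SuperOp C (K × A)}
    (hpost : IsSubchannel post) (hpre : IsSubchannel pre) : IsProbSupermap (comb post pre) := by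
  intro r r' N hN
  rw [extend_comb]
  exact hpost.ampl.comp ((isChannel_reindexMap _).isSubchannel.comp (hN.ampl.comp
    ((isChannel_reindexMap _).isSubchannel.comp hpre.ampl)))

theorem isSuperchannel_comb {post : SuperOp (K × B) D} {pre : SuperOp C (K × A)}
    (hpost : IsChannel post) (hpre : IsChannel pre) : IsSuperchannel (comb post pre) :=
  ⟨isProbSupermap_comb hpost.isSubchannel hpre.isSubchannel, fun _ hN =>
    hpost.comp (hN.ampl.comp hpre)⟩

/-- Scale `N` to a subchannel, extend by one-dimensional references, and scale back. The converse
needs this for differences such as `l₁ • replacer A σ - N`. -/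
theorem IsProbSupermap.isCP {Θ : Supermap A B C D} (hΘ : IsProbSupermap Θ) {N : SuperOp A B}
    (hN : IsCP N) : IsCP (Θ N) := by
  obtain ⟨c, hc, hcN⟩ := hN.exists_isSubchannel_smul
  have h := (hΘ 1 1 _ hcN.ampl).1
  have hcp : IsCP (Θ ((c : ℂ) • N)) := by
    convert (isCP_reindexMap (fun d : D => ((0 : Fin 1), d))).comp
      (h.comp (isCP_reindexMap (Prod.snd : Fin 1 × C → C))) using 1
    ext X d d'
    have h1 : block (0 : Fin 1) 0 ∘ₗ ampl (Fin 1) ((c : ℂ) • N) ∘ₗ inject 0 0 = (c : ℂ) • N := by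
      ext X b b'
      have : block (0 : Fin 1) 0 (inject (0 : Fin 1) 0 X) = X := by
        ext a a'
        simp [block_apply, inject_apply]
      simp only [LinearMap.comp_apply, block_ampl, this]
    simp only [LinearMap.comp_apply, reindexMap_apply]
    simp only [extend, LinearMap.coe_mk, AddHom.coe_mk, Matrix.of_apply, Fin.sum_univ_one]
    erw [h1]
    rfl
  have : Θ N = ((c⁻¹ : ℝ) : ℂ) • Θ ((c : ℂ) • N) := by
    rw [map_smul, smul_smul, ← Complex.ofReal_mul, inv_mul_cancel₀ hc.ne']
    simp
  rw [this]
  exact hcp.smul (inv_nonneg.2 hc.le)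

/-- Discarding Alice's output while feeding Bob `σ` is the same as inserting the channel that
discards and prepares `σ`. The nonsignalling condition thus becomes a statement about replacers. -/
theorem traceLeft_bipartite [DecidableEq B] (Θ : Supermap A B C D) (ρ : Op C) (σ : Op B) :
    traceLeft (bipartite Θ (ρ ⊗ₖ σ)) = Θ (replacer A σ) ρ := by
  have h : replacer A σ = ∑ a, ∑ b, ∑ b', σ b b' • elemMap a a b b' := by
    ext X i j
    simp [replacer_apply, elemMap, Matrix.trace, Matrix.sum_apply, Matrix.single_apply, ite_and,
      Finset.mul_sum, mul_comm]
  have hsub : ∀ b b' : B, (ρ ⊗ₖ σ).submatrix (fun c => (c, b)) (fun c => (c, b')) =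
      σ b b' • ρ := by
    intro b b'
    ext
    simp [Matrix.kroneckerMap_apply, mul_comm]
  ext d d'
  simp [traceLeft, bipartite, h, hsub, Matrix.sum_apply]

end Comb

/-! ### Entanglement assistance as a case of nonsignalling assistance. -/

section Assistance

variable {A B K A' M M' : Type*} [Fintype A] [Fintype B] [Fintype K] [Fintype A'] [Fintype M]
  [Fintype M']

/-- Adjoining a fixed operator on the left. -/
noncomputable def adjoin (M : Type*) (γ : Op K) : SuperOp M (K × M) where
  toFun ρ := γ ⊗ₖ ρ
  map_add' X Y := Matrix.kronecker_add _ X Y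
  map_smul' c X := Matrix.kronecker_smul c _ X

theorem adjoin_apply (γ : Op K) (ρ : Op M) : adjoin M γ ρ = γ ⊗ₖ ρ := rfl

theorem isChannel_adjoin {γ : Op K} (hγ : IsState γ) : IsChannel (adjoin M γ) := by
  classical
  refine ⟨fun r X hX => ?_, fun X => by rw [adjoin_apply, Matrix.trace_kronecker, hγ.2, one_mul]⟩
  exact (hγ.1.kronecker hX).submatrix (prodLeftComm (Fin r) K M)

/-- Alice's encoding, with Bob's half of the shared state as memory. -/
noncomputable def encoder (γ : Op (K × A')) (E : SuperOp (A' × M) A) : SuperOp M (K × A) :=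
  ampl K E ∘ₗ reindexMap (Equiv.prodAssoc K A' M).symm ∘ₗ adjoin M γ

theorem isChannel_encoder {γ : Op (K × A')} {E : SuperOp (A' × M) A} (hγ : IsState γ)
    (hE : IsChannel E) : IsChannel (encoder γ E) :=
  hE.ampl.comp ((isChannel_reindexMap _).comp (isChannel_adjoin hγ))

theorem traceRight_encoder {γ : Op (K × A')} {E : SuperOp (A' × M) A} (hE : IsChannel E)
    (ρ : Op M) : traceRight (encoder γ E ρ) = ρ.trace • traceRight γ := by
  ext k l
  have : traceRight (encoder γ E ρ) k l =
      (E (block k l (reindexMap (Equiv.prodAssoc K A' M).symm (adjoin M γ ρ)))).trace := rfl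
  rw [this, hE.2]
  simp [Matrix.trace, block_apply, reindexMap_apply, adjoin_apply, traceRight,
    Fintype.sum_prod_type, Matrix.kroneckerMap_apply, ← Finset.sum_mul, mul_comm]

/-- The completion of a subchannel to a channel, with a flag telling whether it failed. -/
noncomputable def flagged (τ : Op M') (D : SuperOp A M') : SuperOp A (M' × Fin 2) where
  toFun X := D X ⊗ₖ Matrix.single 0 0 1 + (X.trace - (D X).trace) • (τ ⊗ₖ Matrix.single 1 1 1)
  map_add' X Y := by
    simp only [map_add, Matrix.add_kronecker, Matrix.trace_add]
    module
  map_smul' c X := by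
    simp only [map_smul, Matrix.smul_kronecker, Matrix.trace_smul, RingHom.id_apply, smul_eq_mul]
    module

theorem flagged_apply (τ : Op M') (D : SuperOp A M') (X : Op A) :
    flagged τ D X =
      D X ⊗ₖ Matrix.single 0 0 1 + (X.trace - (D X).trace) • (τ ⊗ₖ Matrix.single 1 1 1) := rfl

/-- Adjoining a fixed operator on the right. -/
noncomputable def adjoinRight (M : Type*) (γ : Op K) : SuperOp M (M × K) where
  toFun ρ := ρ ⊗ₖ γ
  map_add' X Y := Matrix.add_kronecker X Y _
  map_smul' c X := Matrix.smul_kronecker c X _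

theorem isCP_adjoinRight {γ : Op K} (hγ : γ.PosSemidef) : IsCP (adjoinRight M γ) := by
  classical
  intro r X hX
  exact (hX.kronecker hγ).submatrix (Equiv.prodAssoc (Fin r) M K).symm

theorem posSemidef_single [DecidableEq A] (a : A) : (Matrix.single a a (1 : ℂ)).PosSemidef := by
  rw [← Matrix.diagonal_single]
  exact Matrix.PosSemidef.diagonal (Pi.single_nonneg.2 zero_le_one)

/-- This matrix is the transpose of `1 - D†(1)`; its quadratic form at `v` is the trace that `D`
loses on a rank-one positive operator. -/
theorem posSemidef_trace_deficit [DecidableEq A] {D : SuperOp A M'} (hD : IsSubchannel D) :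
    (Matrix.of fun a a' => (Matrix.single a a' (1 : ℂ)).trace -
      (D (Matrix.single a a' 1)).trace : Op A).PosSemidef := by
  set G : Op A := Matrix.of fun a a' => (Matrix.single a a' (1 : ℂ)).trace -
      (D (Matrix.single a a' 1)).trace with hGdef
  have hG : G = 1 - traceLeft (choi D) := by
    ext a a'
    have : G a a' = (Matrix.single a a' (1 : ℂ)).trace -
        ∑ m, D (Matrix.single a a' 1) m m := rfl
    rw [this]
    by_cases h : a = a'
    · simp [traceLeft, choi, h]
    · simp [traceLeft, choi, Matrix.trace_single_eq_of_ne, h]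
  have hGq : ∀ v : A → ℂ, star v ⬝ᵥ (G.mulVec v) =
      (Matrix.vecMulVec (star v) v).trace - (D (Matrix.vecMulVec (star v) v)).trace := by
    intro v
    conv_rhs => rw [Matrix.matrix_eq_sum_single (Matrix.vecMulVec (star v) v)]
    have : ∀ (a a' : A) (c : ℂ), Matrix.single a a' c = c • Matrix.single a a' (1 : ℂ) := by simp
    simp only [this _ _ (Matrix.vecMulVec (star v) v _ _), map_sum, map_smul,
      Matrix.trace_sum, Matrix.trace_smul, ← Finset.sum_sub_distrib, ← smul_sub]
    simp only [dotProduct, Matrix.mulVec, Finset.mul_sum, Matrix.vecMulVec_apply, smul_eq_mul]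
    refine Finset.sum_congr rfl fun a _ => Finset.sum_congr rfl fun a' _ => ?_
    rw [hGdef, Matrix.of_apply]
    ring
  apply Matrix.PosSemidef.of_dotProduct_mulVec_nonneg
  · rw [hG]
    refine Matrix.isHermitian_one.sub (Matrix.IsHermitian.ext fun a a' => ?_)
    simp only [traceLeft, Matrix.of_apply, star_sum]
    exact Finset.sum_congr rfl fun m _ => hD.1.choi_posSemidef.1.apply _ _
  · intro v
    rw [hGq, sub_nonneg]
    have hv := Matrix.posSemidef_vecMulVec_star_self v
    rw [trace_eq_ofReal hv, trace_eq_ofReal (hD.1.posSemidef hv)]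
    exact_mod_cast hD.2 _ hv

theorem isChannel_flagged {τ : Op M'} (hτ : IsState τ) {D : SuperOp A M'} (hD : IsSubchannel D) :
    IsChannel (flagged τ D) := by
  classical
  constructor
  · let g : SuperOp A (M' × Fin 2) :=
      (Matrix.traceLinearMap A ℂ ℂ - Matrix.traceLinearMap M' ℂ ℂ ∘ₗ D).smulRight
        (τ ⊗ₖ Matrix.single 1 1 1)
    have h2 : IsCP g := by
      apply isCP_of_choi
      have h := (hτ.1.kronecker (posSemidef_single (1 : Fin 2))).kronecker
        (posSemidef_trace_deficit hD)
      have hg : choi g = (τ ⊗ₖ Matrix.single (1 : Fin 2) 1 1) ⊗ₖ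
          (Matrix.of fun a a' => (Matrix.single a a' (1 : ℂ)).trace -
            (D (Matrix.single a a' 1)).trace : Op A) := by
        ext p q
        simp only [choi, g, Matrix.kroneckerMap_apply, Matrix.of_apply]
        exact mul_comm _ _
      rw [hg]
      exact h
    have h1 : IsCP (adjoinRight M' (Matrix.single (0 : Fin 2) 0 1)) :=
      isCP_adjoinRight (posSemidef_single (0 : Fin 2))
    have : flagged τ D = adjoinRight M' (Matrix.single (0 : Fin 2) 0 1) ∘ₗ D + g :=
      LinearMap.ext fun X => rfl
    rw [this]
    exact (h1.comp hD.1).add h2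
  · intro X
    rw [flagged_apply, Matrix.trace_add, Matrix.trace_smul, Matrix.trace_kronecker,
      Matrix.trace_kronecker, hτ.2]
    simp

/-- Keeping the message of the flag value `0`. -/
def keep (M' : Type*) : SuperOp (M' × Fin 2) M' := reindexMap fun m => (m, 0)

theorem isSubchannel_keep : IsSubchannel (keep M') := by
  refine ⟨isCP_reindexMap _, fun X hX => ?_⟩
  simp only [Matrix.trace, Matrix.diag, Fintype.sum_prod_type, Fin.sum_univ_two, keep,
    reindexMap_apply, Finset.sum_add_distrib, Complex.add_re, Complex.re_sum]
  exact le_add_of_nonneg_right (Finset.sum_nonneg fun m _ => (Complex.le_def.1 hX.diag_nonneg).1)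

theorem keep_flagged (τ : Op M') (D : SuperOp A M') (X : Op A) : keep M' (flagged τ D X) = D X := by
  ext m m'
  simp [keep, reindexMap_apply, flagged_apply, Matrix.kroneckerMap_apply]

theorem exists_isState (A : Type*) [Fintype A] [Nonempty A] : ∃ σ : Op A, IsState σ := by
  classical
  obtain ⟨a⟩ := ‹Nonempty A›
  exact ⟨Matrix.single a a 1, posSemidef_single a, by simp⟩

/-- Nonsignalling holds because Alice's encoding preserves the trace, so Bob's share has the
marginal of `γ` whatever the message is. -/
theorem IsPEA.isPNA [DecidableEq B] [Nonempty M'] {Θ : Supermap A B M M'} (hΘ : IsPEA Θ) :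
    IsPNA Θ := by
  obtain ⟨hprob, a', b', γ, E, D, hγ, hE, hD, h⟩ := hΘ
  obtain ⟨τ, hτ⟩ := exists_isState M'
  refine ⟨hprob, comb (flagged τ D) (encoder γ E), keep M',
    ⟨isSuperchannel_comb (isChannel_flagged hτ hD) (isChannel_encoder hγ hE), ?_⟩, ?_,
    isSubchannel_keep, ?_⟩
  · intro ρ ω σ hρ hω _
    rw [traceLeft_bipartite, traceLeft_bipartite, comb_apply, comb_apply, ampl_replacer,
      ampl_replacer, traceRight_encoder hE, traceRight_encoder hE, hρ.2, hω.2]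
  · intro N ρ m m' x x' hx
    rw [comb_apply, flagged_apply]
    fin_cases x <;> fin_cases x' <;> simp_all [Matrix.kroneckerMap_apply]
  · intro N ρ
    rw [comb_apply, keep_flagged, h]
    rfl

end Assistance

/-! ### Maximally entangled and pure states. -/

section MaxEnt

variable {A B K : Type*} [Fintype A] [Fintype B] [Fintype K] [DecidableEq A]

/-- The amplitudes of the maximally entangled state of two systems identified by `e`. -/
noncomputable def maxEntVec (e : K ≃ A) : K × A → ℂ :=
  fun p => if e p.1 = p.2 then ((Real.sqrt (Fintype.card A))⁻¹ : ℝ) else 0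

/-- The maximally entangled state of two systems identified by `e`. -/
noncomputable def maxEnt (e : K ≃ A) : Op (K × A) :=
  Matrix.vecMulVec (maxEntVec e) (star (maxEntVec e))

theorem maxEnt_apply (e : K ≃ A) (p q : K × A) :
    maxEnt e p q = if e p.1 = p.2 ∧ e q.1 = q.2 then (Fintype.card A : ℂ)⁻¹ else 0 := by
  have h : (((Real.sqrt (Fintype.card A))⁻¹ : ℝ) : ℂ) * (((Real.sqrt (Fintype.card A))⁻¹ : ℝ) : ℂ)
      = (Fintype.card A : ℂ)⁻¹ := by
    rw [← Complex.ofReal_mul, ← mul_inv, Real.mul_self_sqrt (by positivity)]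
    simp
  by_cases h1 : e p.1 = p.2 <;> by_cases h2 : e q.1 = q.2 <;>
    simp [maxEnt, Matrix.vecMulVec_apply, maxEntVec, h1, h2]
  simpa using h

theorem block_maxEnt (e : K ≃ A) (k l : K) :
    block k l (maxEnt e) = (Fintype.card A : ℂ)⁻¹ • Matrix.single (e k) (e l) 1 := by
  ext a a'
  simp [block_apply, maxEnt_apply, Matrix.single_apply]

theorem maxEnt_posSemidef (e : K ≃ A) : (maxEnt e).PosSemidef :=
  Matrix.posSemidef_vecMulVec_self_star _

theorem maxEnt_trace [Nonempty A] (e : K ≃ A) : (maxEnt e).trace = 1 := by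
  simp [trace_eq_sum_block, block_maxEnt, Fintype.card_congr e]

theorem isState_maxEnt [Nonempty A] (e : K ≃ A) : IsState (maxEnt e) :=
  ⟨maxEnt_posSemidef e, maxEnt_trace e⟩

theorem isPureState_maxEnt [Nonempty A] (e : K ≃ A) : IsPureState (maxEnt e) := by
  refine ⟨maxEntVec e, ?_, rfl⟩
  rw [← maxEnt_trace e, maxEnt, Matrix.trace_vecMulVec, dotProduct_comm]

theorem isCP_of_maxEnt [Nonempty A] (e : K ≃ A) {N : SuperOp A B}
    (h : (ampl K N (maxEnt e)).PosSemidef) : IsCP N := by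
  apply isCP_of_choi
  have h2 := (PosSemidef.real_smul h (c := Fintype.card A) (by positivity)).submatrix
    (fun p : B × A => (e.symm p.2, p.1))
  convert h2 using 1
  ext p q
  simp [choi, ampl_apply, block_maxEnt, -Matrix.smul_single]

end MaxEnt

section Pure

variable {n : Type*} [Fintype n]

theorem one_sub_pure_posSemidef [DecidableEq n] {ψ : Op n} (hψ : IsPureState ψ) :
    (1 - ψ).PosSemidef := by
  obtain ⟨v, hv, rfl⟩ := hψ
  have h1 : (Matrix.vecMulVec v (star v)).conjTranspose = Matrix.vecMulVec v (star v) :=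
    (Matrix.posSemidef_vecMulVec_self_star v).1
  have h2 : Matrix.vecMulVec v (star v) * Matrix.vecMulVec v (star v) =
      Matrix.vecMulVec v (star v) := by
    rw [Matrix.vecMulVec_mul_vecMulVec, hv]; simp
  have : 1 - Matrix.vecMulVec v (star v) =
      (1 - Matrix.vecMulVec v (star v)).conjTranspose * (1 - Matrix.vecMulVec v (star v)) := by
    rw [Matrix.conjTranspose_sub, Matrix.conjTranspose_one, h1, sub_mul, mul_sub, mul_sub, h2]
    simp
  rw [this]
  exact Matrix.posSemidef_conjTranspose_mul_self _

theorem IsPureState.posSemidef {ψ : Op n} (hψ : IsPureState ψ) : ψ.PosSemidef := by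
  obtain ⟨v, -, rfl⟩ := hψ
  exact Matrix.posSemidef_vecMulVec_self_star v

end Pure

/-! ### The converse bound. -/

section Replacer

variable {A B : Type*} [Fintype A] [Fintype B]

theorem isCP_replacer {σ : Op B} (hσ : σ.PosSemidef) : IsCP (replacer A σ) := by
  classical
  apply isCP_of_choi
  rw [choi_replacer]
  exact hσ.kronecker Matrix.PosSemidef.one

/-- A linear map that vanishes on positive semidefinite operators is zero. -/
theorem eq_zero_of_posSemidef {L : SuperOp A B}
    (h : ∀ P : Op A, P.PosSemidef → L P = 0) : L = 0 := by
  classical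
  have hs : ∀ i j : A, L (Matrix.single i j 1) = 0 := by
    intro i j
    let w : ℂ → Op A := fun c => Matrix.vecMulVec (Pi.single i 1 + c • Pi.single j 1)
      (star (Pi.single i 1 + c • Pi.single j 1))
    have hw : ∀ c, L (w c) = 0 := fun c => h _ (Matrix.posSemidef_vecMulVec_self_star _)
    have hexp : ∀ c, w c = Matrix.single i i 1 + (star c) • Matrix.single i j 1 +
        c • Matrix.single j i 1 + (c * star c) • Matrix.single j j 1 := by
      intro c
      have h1 : ∀ i : A, star (Pi.single i (1 : ℂ) : A → ℂ) = Pi.single i 1 := fun i => by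
        rw [← Pi.single_star, star_one]
      simp only [w, star_add, star_smul, h1, Matrix.add_vecMulVec, Matrix.vecMulVec_add,
        Matrix.smul_vecMulVec, Matrix.vecMulVec_smul, Matrix.single_eq_single_vecMulVec_single]
      module
    -- Polarization: four rank-one positive operators, with the fourth roots of unity as phases,
    -- span the off-diagonal unit.
    have hsum : (4 : ℂ) • Matrix.single i j (1 : ℂ) =
        w 1 - w (-1) + Complex.I • w Complex.I - Complex.I • w (-Complex.I) := by
      simp only [hexp, smul_add, smul_smul]
      simp only [star_one, star_neg, Complex.star_def, Complex.conj_I]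
      match_scalars <;> ring_nf <;> simp
      norm_num
    have h4 : (4 : ℂ) • L (Matrix.single i j (1 : ℂ)) = 0 := by
      rw [← map_smul, hsum]
      simp only [map_sub, map_add, map_smul, hw]
      simp
    exact (smul_eq_zero.1 h4).resolve_left (by norm_num)
  ext X : 1
  rw [Matrix.matrix_eq_sum_single X]
  have : ∀ (a a' : A) (c : ℂ), Matrix.single a a' c = c • Matrix.single a a' (1 : ℂ) := by simp
  simp only [map_sum, this _ _ (X _ _), map_smul, hs]
  simp

theorem exists_eq_replacer [Nonempty A] {L : SuperOp A B}
    (h : ∀ ρ ω : Op A, IsState ρ → IsState ω → L ρ = L ω) : ∃ τ, L = replacer A τ := by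
  obtain ⟨ρ, hρ⟩ := exists_isState A
  refine ⟨L ρ, sub_eq_zero.1 (eq_zero_of_posSemidef fun P hP => ?_)⟩
  rw [LinearMap.sub_apply, replacer_apply, sub_eq_zero]
  by_cases h0 : P.trace = 0
  · rw [hP.trace_eq_zero_iff.1 h0]; simp
  · have hst : IsState (P.trace⁻¹ • P) := by
      refine ⟨?_, by rw [Matrix.trace_smul, smul_eq_mul, inv_mul_cancel₀ h0]⟩
      rw [trace_eq_ofReal hP, ← Complex.ofReal_inv]
      exact PosSemidef.real_smul hP (inv_nonneg.2 (trace_re_nonneg hP))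
    rw [h _ _ hρ hst, map_smul, smul_smul, mul_inv_cancel₀ h0, one_smul]

theorem IsPNA.exists_replacer {M M' : Type*} [Fintype M] [Fintype M'] [DecidableEq B] [Nonempty M]
    {Θ : Supermap A B M M'} (hΘ : IsPNA Θ) {σ : Op B} (hσ : IsState σ) :
    ∃ τ, Θ (replacer A σ) = replacer M τ := by
  obtain ⟨-, Ξ, D, ⟨-, hns⟩, -, -, h⟩ := hΘ
  apply exists_eq_replacer
  intro ρ ω hρ hω
  have := hns ρ ω σ hρ hω hσ
  rw [traceLeft_bipartite, traceLeft_bipartite] at this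
  rw [h, h, this]

end Replacer

section Converse

variable {A B : Type*} [Fintype A] [Fintype B]

theorem condFidelity_nonneg {M R : Type*} [Fintype M] [Fintype R] {N : SuperOp M M}
    (hN : IsCP N) {ψ : Op (R × M)} (hψ : ψ.PosSemidef) : 0 ≤ condFidelity N ψ :=
  div_nonneg (Complex.le_def.1 (trace_mul_nonneg hψ (hN.ampl_posSemidef hψ))).1
    (trace_re_nonneg (hN.ampl_posSemidef hψ))

theorem le_condFidelity {M : Type*} [Fintype M] {N : SuperOp M M} (hN : IsCP N) {ε : ℝ}
    (h : quantumError N ≤ ε) {r : ℕ} {ψ : Op (Fin r × M)} (hψ : IsPureState ψ) :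
    1 - ε ≤ condFidelity N ψ := by
  have hb : BddBelow {f : ℝ | ∃ (r : ℕ) (ψ : Op (Fin r × M)),
      IsPureState ψ ∧ f = condFidelity N ψ} := by
    refine ⟨0, ?_⟩
    rintro _ ⟨r, ψ, hψ, rfl⟩
    exact condFidelity_nonneg hN hψ.posSemidef
  have := csInf_le hb ⟨r, ψ, hψ, rfl⟩
  unfold quantumError at h
  linarith

theorem sq_sub_one_le [DecidableEq B] {d : ℕ} (hd : 0 < d) {Θ : Supermap A B (Fin d) (Fin d)}
    (hΘ : IsPNA Θ) {N : SuperOp A B} (hN : IsCP N) {σ : Op B} (hσ : IsState σ) {l₁ l₂ : ℝ}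
    (hl₂ : 0 ≤ l₂) (h₁ : IsCP ((l₁ : ℂ) • replacer A σ - N))
    (h₂ : IsCP ((l₂ : ℂ) • N - replacer A σ)) {ε : ℝ} (hε0 : 0 < ε) (hε1 : ε < 1)
    (herr : quantumError (Θ N) ≤ ε) : (d : ℝ) ^ 2 - 1 ≤ ε / (1 - ε) * (l₁ * l₂) := by
  have : Nonempty (Fin d) := ⟨⟨0, hd⟩⟩
  obtain ⟨τ, hτ⟩ := hΘ.exists_replacer hσ
  set Φ : Op (Fin d × Fin d) := maxEnt (Equiv.refl (Fin d)) with hΦ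
  have hΦp : IsPureState Φ := isPureState_maxEnt _
  set Z := ampl (Fin d) (Θ N) Φ with hZ
  set W := ampl (Fin d) (replacer (Fin d) τ) Φ with hW
  have hcpN := hΘ.1.isCP hN
  have hfid : 1 - ε ≤ (Φ * Z).trace.re / Z.trace.re := le_condFidelity hcpN herr hΦp
  have hZp : Z.PosSemidef := hcpN.ampl_posSemidef hΦp.posSemidef
  have hV₁ : ((l₁ : ℂ) • W - Z).PosSemidef := by
    have := (hΘ.1.isCP h₁).ampl_posSemidef hΦp.posSemidef (K := Fin d)
    rw [map_sub, map_smul, hτ] at this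
    exact this
  have hV₂ : ((l₂ : ℂ) • Z - W).PosSemidef := by
    have := (hΘ.1.isCP h₂).ampl_posSemidef hΦp.posSemidef (K := Fin d)
    rw [map_sub, map_smul, hτ] at this
    exact this
  have hd0 : (d : ℂ) ≠ 0 := by exact_mod_cast hd.ne'
  have hWtr : W.trace = τ.trace := by
    simp [hW, hΦ, trace_ampl, block_maxEnt, replacer_apply, hd0]
  have hΦW : (Φ * W).trace = τ.trace / (d : ℂ) ^ 2 := by
    have hWa : ∀ p q, W p q = if p.1 = q.1 then (d : ℂ)⁻¹ * τ p.2 q.2 else 0 := by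
      intro p q
      rw [hW, hΦ, ampl_apply, block_maxEnt, replacer_apply]
      by_cases h : p.1 = q.1
      · simp [h]
      · simp [h, Matrix.trace_single_eq_of_ne]
    simp only [Matrix.trace, Matrix.diag, Matrix.mul_apply, Fintype.sum_prod_type, hΦ,
      maxEnt_apply, hWa, Equiv.refl_apply, Fintype.card_fin, ite_and, ite_mul, mul_ite, zero_mul,
      mul_zero, Finset.sum_ite_eq, Finset.sum_ite_irrel, Finset.sum_const_zero, Finset.mem_univ,
      if_true, Finset.sum_div]
    refine Finset.sum_congr rfl fun i _ => ?_
    rw [Finset.sum_eq_single i (fun j _ hj => by simp [hj.symm]) (by simp),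
      Finset.sum_eq_single i (fun j _ hj => by simp [hj]) (by simp)]
    simp only [if_true]
    field_simp
  -- Success is bounded above by testing `Z ≤ l₁ W` with `Φ`, and failure below by testing `W ≤ l₂
  -- Z` with `1 - Φ`.
  have e1 := Complex.le_def.1 (trace_mul_nonneg hΦp.posSemidef hV₁)
  have e2 := Complex.le_def.1 (trace_mul_nonneg (one_sub_pure_posSemidef hΦp) hV₂)
  have hτre : (τ.trace / (d : ℂ) ^ 2).re = τ.trace.re / (d : ℝ) ^ 2 := by
    rw [← Complex.ofReal_natCast, ← Complex.ofReal_pow, Complex.div_ofReal_re]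
  replace e1 := e1.1
  replace e2 := e2.1
  simp only [mul_sub, sub_mul, one_mul, Matrix.mul_smul, Matrix.trace_sub, Matrix.trace_smul,
    hΦW, hWtr, Complex.sub_re, Complex.zero_re, smul_eq_mul, Complex.re_ofReal_mul, hτre] at e1 e2
  have ht0 := trace_re_nonneg hZp
  set s := (Φ * Z).trace.re
  set t := Z.trace.re
  set w := τ.trace.re
  -- If `t = 0`, the convention `0 / 0 = 0` would contradict a fidelity of at least `1 - ε > 0`.
  have ht : 0 < t := by
    rcases ht0.lt_or_eq with h | h
    · exact h
    · rw [← h, div_zero] at hfid; linarith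
  rw [le_div_iff₀ ht] at hfid
  have hs : 0 < s := lt_of_lt_of_le (mul_pos (by linarith) ht) hfid
  have hD : (1 : ℝ) ≤ (d : ℝ) ^ 2 := one_le_pow₀ (by exact_mod_cast hd)
  set D := (d : ℝ) ^ 2
  have hDpos : 0 < D := by linarith
  rw [div_mul_eq_mul_div, le_div_iff₀ (by linarith)]
  have f1 : s * D ≤ l₁ * w := by
    have := mul_le_mul_of_nonneg_right (sub_nonneg.1 e1) hDpos.le
    rwa [mul_assoc, div_mul_cancel₀ _ hDpos.ne'] at this
  have f2 : w * (D - 1) ≤ l₂ * (t - s) * D := by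
    have : w - w / D ≤ l₂ * (t - s) := by linarith
    have := mul_le_mul_of_nonneg_right this hDpos.le
    rw [sub_mul, div_mul_cancel₀ _ hDpos.ne'] at this
    linarith
  -- The final inequality is multiplied by `w`, which has to be cancelled; `w = 0` would rule out
  -- any success.
  have hw : 0 < w := by
    have h0 : 0 ≤ w := by
      have hcp : IsCP (Θ (replacer A σ)) := hΘ.1.isCP (isCP_replacer hσ.1)
      rw [hτ] at hcp
      have := trace_re_nonneg (hcp.ampl_posSemidef (K := Fin d) hΦp.posSemidef)
      rwa [hWtr] at this
    refine h0.lt_of_ne fun h => ?_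
    rw [← h, mul_zero] at f1
    exact absurd f1 (not_le.2 (mul_pos hs hDpos))
  have f3 : (1 - ε) * (t - s) ≤ ε * s := by linarith
  have f4 : w * ((D - 1) * (1 - ε)) ≤ w * (ε * (l₁ * l₂)) :=
    calc w * ((D - 1) * (1 - ε)) = w * (D - 1) * (1 - ε) := by ring
      _ ≤ l₂ * (t - s) * D * (1 - ε) := mul_le_mul_of_nonneg_right f2 (by linarith)
      _ = l₂ * D * ((1 - ε) * (t - s)) := by ring
      _ ≤ l₂ * D * (ε * s) := mul_le_mul_of_nonneg_left f3 (by positivity)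
      _ = l₂ * ε * (s * D) := by ring
      _ ≤ l₂ * ε * (l₁ * w) := mul_le_mul_of_nonneg_left f1 (by positivity)
      _ = w * (ε * (l₁ * l₂)) := by ring
  exact le_of_mul_le_mul_left f4 hw

end Converse

/-! ### Conic duality for the sandwich condition. -/

section Duality

variable {A B n : Type*} [Fintype A] [Fintype B] [Fintype n]

theorem locallyConvexSpace_op : LocallyConvexSpace ℝ (Op n) :=
  inferInstanceAs (LocallyConvexSpace ℝ (n → n → ℂ))

theorem firstCountableTopology_op : FirstCountableTopology (Op n) :=
  inferInstanceAs (FirstCountableTopology (n → n → ℂ))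

theorem isClosed_posSemidef : IsClosed {P : Op n | P.PosSemidef} := by
  have : {P : Op n | P.PosSemidef} = {P | P.conjTranspose = P} ∩
      ⋂ v : n → ℂ, {P | 0 ≤ star v ⬝ᵥ P.mulVec v} := by
    ext P
    simp only [Set.mem_ofPred_eq, Set.mem_inter_iff, Set.mem_iInter]
    exact Matrix.posSemidef_iff_dotProduct_mulVec
  rw [this]
  refine (isClosed_eq (by fun_prop) (by fun_prop)).inter (isClosed_iInter fun v => ?_)
  exact isClosed_le continuous_const (by fun_prop)

/-- The bilinear pairing `∑ X p q * Z p q`. -/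
noncomputable def pairing (X Z : Op n) : ℂ := (X * Z.transpose).trace

theorem pairing_eq_sum (X Z : Op n) : pairing X Z = ∑ p, ∑ q, X p q * Z p q := by
  simp [pairing, Matrix.trace, Matrix.mul_apply]

theorem pairing_add_left (X Y Z : Op n) : pairing (X + Y) Z = pairing X Z + pairing Y Z := by
  simp [pairing, Matrix.add_mul]

theorem pairing_smul_left (c : ℂ) (X Z : Op n) : pairing (c • X) Z = c * pairing X Z := by
  simp [pairing]

theorem pairing_one_left [DecidableEq n] (Z : Op n) : pairing 1 Z = Z.trace := by
  simp [pairing]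

theorem pairing_nonneg {X Z : Op n} (hX : X.PosSemidef) (hZ : Z.PosSemidef) : 0 ≤ pairing X Z :=
  trace_mul_nonneg hX hZ.transpose

theorem pairing_kronecker_one [DecidableEq A] (X : Op (B × A)) (σ : Op B) :
    pairing X (σ ⊗ₖ (1 : Op A)) = pairing (traceRight X) σ := by
  simp only [pairing_eq_sum, Fintype.sum_prod_type, Matrix.kroneckerMap_apply, traceRight,
    Matrix.one_apply, mul_ite, mul_one, mul_zero, Finset.sum_ite_eq, Finset.mem_univ, if_true,
    Matrix.of_apply, Finset.sum_mul]
  exact Finset.sum_congr rfl fun b _ => Finset.sum_comm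

theorem kronecker_one_isHermitian [DecidableEq A] {σ : Op B} (hσ : σ.IsHermitian) :
    (σ ⊗ₖ (1 : Op A)).IsHermitian := by
  rw [Matrix.IsHermitian, Matrix.conjTranspose_kronecker, hσ, Matrix.conjTranspose_one]

/-- The cone of pairs that dominate `(σ ⊗ 1, -μ σ ⊗ 1)` for some Hermitian `σ`. -/
def dominatingCone (A B : Type*) [Fintype A] [Fintype B] [DecidableEq A] (μ : ℝ) :
    Set (Op (B × A) × Op (B × A)) :=
  {z | ∃ σ : Op B, σ.IsHermitian ∧ (z.1 - σ ⊗ₖ (1 : Op A)).PosSemidef ∧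
    (z.2 + (μ : ℂ) • (σ ⊗ₖ (1 : Op A))).PosSemidef}

theorem convex_dominatingCone [DecidableEq A] (μ : ℝ) : Convex ℝ (dominatingCone A B μ) := by
  rintro x ⟨σ, hσ, h1, h2⟩ y ⟨τ, hτ, h3, h4⟩ a b ha hb -
  refine ⟨(a : ℂ) • σ + (b : ℂ) • τ, ?_, ?_, ?_⟩
  · exact (hσ.smul (by simp [IsSelfAdjoint])).add (hτ.smul (by simp [IsSelfAdjoint]))
  · convert (PosSemidef.real_smul h1 ha).add (PosSemidef.real_smul h3 hb) using 1
    simp only [Prod.fst_add, Prod.smul_fst, Matrix.add_kronecker, Matrix.smul_kronecker,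
      ← Complex.coe_smul]
    module
  · convert (PosSemidef.real_smul h2 ha).add (PosSemidef.real_smul h4 hb) using 1
    simp only [Prod.snd_add, Prod.smul_snd, Matrix.add_kronecker, Matrix.smul_kronecker,
      ← Complex.coe_smul]
    module

/-- The witnesses stay bounded along a convergent sequence: `μ z.1 + z.2` is `μ` times the first
positive slack plus the second, so its trace controls the first slack and hence `σ`. A limit point
of the witnesses is a witness for the limit. -/
theorem isClosed_dominatingCone [DecidableEq A] [Nonempty A] {μ : ℝ} (hμ : 0 < μ) :
    IsClosed (dominatingCone A B μ) := by
  obtain ⟨a₀⟩ := ‹Nonempty A›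
  have := firstCountableTopology_op (n := B × A)
  apply IsSeqClosed.isClosed
  intro z w hz hzw
  choose σ hσ h1 h2 using hz
  let Z : ℕ → B × A → B × A → ℂ := fun n => (z n).1
  have hz1 : Filter.Tendsto Z Filter.atTop (nhds (w.1 : B × A → B × A → ℂ)) :=
    (continuous_fst.tendsto w).comp hzw
  obtain ⟨C₁, hC₁⟩ := hz1.norm.bddAbove_range
  have ht : Filter.Tendsto (fun n => (((μ : ℂ) • (z n).1 + (z n).2).trace.re)) Filter.atTop
      (nhds (((μ : ℂ) • w.1 + w.2).trace.re)) := by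
    have hc : Continuous fun x : Op (B × A) × Op (B × A) => (((μ : ℂ) • x.1 + x.2).trace.re) := by
      fun_prop
    exact (hc.tendsto w).comp hzw
  obtain ⟨C₂, hC₂⟩ := ht.bddAbove_range
  let S : ℕ → B → B → ℂ := σ
  have hbound : ∀ n, S n ∈ Metric.closedBall (0 : B → B → ℂ) (max (C₁ + C₂ / μ) 0) := by
    intro n
    rw [mem_closedBall_zero_iff, pi_norm_le_iff_of_nonneg (le_max_right _ _)]
    intro b
    rw [pi_norm_le_iff_of_nonneg (le_max_right _ _)]
    intro b'
    refine le_trans ?_ (le_max_left _ _)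
    have e1 : S n b b' = (z n).1 (b, a₀) (b', a₀) -
        ((z n).1 - σ n ⊗ₖ (1 : Op A)) (b, a₀) (b', a₀) := by
      simp [S, Matrix.kroneckerMap_apply]
    have e2 : ‖(z n).1 (b, a₀) (b', a₀)‖ ≤ C₁ :=
      ((norm_le_pi_norm (Z n (b, a₀)) _).trans (norm_le_pi_norm (Z n) _)).trans (hC₁ ⟨n, rfl⟩)
    have e3 : ‖((z n).1 - σ n ⊗ₖ (1 : Op A)) (b, a₀) (b', a₀)‖ ≤ C₂ / μ := by
      refine (norm_entry_le_trace (h1 n) _ _).trans ?_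
      rw [le_div_iff₀ hμ]
      refine le_trans ?_ (hC₂ ⟨n, rfl⟩)
      have h3 := trace_re_nonneg (h2 n)
      have h4 : (((μ : ℂ) • (z n).1 + (z n).2).trace.re) =
          ((z n).1 - σ n ⊗ₖ (1 : Op A)).trace.re * μ +
            ((z n).2 + (μ : ℂ) • (σ n ⊗ₖ (1 : Op A))).trace.re := by
        simp only [Matrix.trace_add, Matrix.trace_sub, Matrix.trace_smul, smul_eq_mul,
          Complex.add_re, Complex.sub_re, Complex.re_ofReal_mul]
        ring
      simp only [h4]
      linarith
    rw [e1]
    exact (norm_sub_le _ _).trans (add_le_add e2 e3)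
  obtain ⟨τ, -, φ, hφ, hτ⟩ := tendsto_subseq_of_bounded Metric.isBounded_closedBall hbound
  replace hτ : Filter.Tendsto (σ ∘ φ) Filter.atTop (nhds (τ : Op B)) := hτ
  have hw : Filter.Tendsto (fun n => (z (φ n), σ (φ n))) Filter.atTop (nhds (w, τ)) :=
    (hzw.comp hφ.tendsto_atTop).prodMk_nhds hτ
  have hk : Continuous fun σ : Op B => σ ⊗ₖ (1 : Op A) := by
    refine continuous_matrix fun p q => ?_
    simp only [Matrix.kroneckerMap_apply]
    fun_prop
  have hk2 : Continuous fun x : (Op (B × A) × Op (B × A)) × Op B => x.2 ⊗ₖ (1 : Op A) :=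
    hk.comp continuous_snd
  refine ⟨τ, ?_, ?_, ?_⟩
  · have hcl : IsClosed {P : Op B | P.conjTranspose = P} :=
      isClosed_eq (by fun_prop) (by fun_prop)
    exact hcl.mem_of_tendsto hτ (Filter.Eventually.of_forall fun n => hσ _)
  · have hc : Continuous fun x : (Op (B × A) × Op (B × A)) × Op B => x.1.1 - x.2 ⊗ₖ (1 : Op A) :=
      (by fun_prop : Continuous fun x : (Op (B × A) × Op (B × A)) × Op B => x.1.1).sub
        hk2
    exact isClosed_posSemidef.mem_of_tendsto ((hc.tendsto _).comp hw)
      (Filter.Eventually.of_forall fun n => h1 _)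
  · have hc : Continuous fun x : (Op (B × A) × Op (B × A)) × Op B =>
        x.1.2 + (μ : ℂ) • (x.2 ⊗ₖ (1 : Op A)) :=
      (by fun_prop : Continuous fun x : (Op (B × A) × Op (B × A)) × Op B => x.1.2).add
        (hk2.const_smul (μ : ℂ))
    exact isClosed_posSemidef.mem_of_tendsto ((hc.tendsto _).comp hw)
      (Filter.Eventually.of_forall fun n => h2 _)

/-- Take the Hermitian part of the coefficient matrix of `f`: on Hermitian arguments, passing to the
adjoint matrix conjugates the pairing. -/
theorem exists_hermitian_pairing [DecidableEq n] (f : Op n →ₗ[ℂ] ℂ) :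
    ∃ X : Op n, X.IsHermitian ∧ ∀ P : Op n, P.IsHermitian → ((f P).re : ℂ) = pairing X P := by
  let U : Op n := Matrix.of fun p q => f (Matrix.single p q 1)
  have hf : ∀ P, f P = pairing U P := by
    intro P
    have : ∀ (a a' : n) (c : ℂ), Matrix.single a a' c = c • Matrix.single a a' (1 : ℂ) := by simp
    conv_lhs => rw [Matrix.matrix_eq_sum_single P]
    simp only [map_sum, this _ _ (P _ _), map_smul, pairing_eq_sum]
    simp [U, mul_comm]
  refine ⟨(2⁻¹ : ℂ) • (U + U.conjTranspose), ?_, fun P hP => ?_⟩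
  · rw [Matrix.IsHermitian, Matrix.conjTranspose_smul, Matrix.conjTranspose_add,
      Matrix.conjTranspose_conjTranspose, add_comm]
    simp
  · have h : pairing U.conjTranspose P = star (pairing U P) := by
      rw [pairing_eq_sum, pairing_eq_sum, Finset.sum_comm]
      simp only [star_sum, star_mul', Matrix.conjTranspose_apply]
      refine Finset.sum_congr rfl fun p _ => Finset.sum_congr rfl fun q _ => ?_
      rw [hP.apply]
    rw [pairing_smul_left, pairing_add_left, h, hf, Complex.re_eq_add_conj, Complex.star_def]
    ring

theorem posSemidef_of_pairing {X : Op n} (hX : X.IsHermitian)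
    (h : ∀ P : Op n, P.PosSemidef → 0 ≤ (pairing X P).re) : X.PosSemidef := by
  refine Matrix.PosSemidef.of_dotProduct_mulVec_nonneg hX fun v => ?_
  have e : star v ⬝ᵥ X.mulVec v = pairing X (Matrix.vecMulVec (star v) v) := by
    simp only [pairing_eq_sum, dotProduct, Matrix.mulVec, Finset.mul_sum, Matrix.vecMulVec_apply]
    exact Finset.sum_congr rfl fun p _ => Finset.sum_congr rfl fun q _ => by ring
  have him : (star v ⬝ᵥ X.mulVec v).im = 0 := hX.im_star_dotProduct_mulVec_self v
  rw [Complex.le_def]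
  refine ⟨?_, him.symm⟩
  rw [e]
  exact h _ (Matrix.posSemidef_vecMulVec_star_self v)

theorem exists_dual [DecidableEq A] [Nonempty A] {J : Op (B × A)} (hJ : J.PosSemidef)
    {μ : ℝ} (hμ : 0 < μ)
    (h : ¬ ∃ σ : Op B, σ.IsHermitian ∧ (J - σ ⊗ₖ (1 : Op A)).PosSemidef ∧
      ((μ : ℂ) • (σ ⊗ₖ (1 : Op A)) - J).PosSemidef) :
    ∃ X Y : Op (B × A), X.PosSemidef ∧ Y.PosSemidef ∧
      traceRight X = (μ : ℂ) • traceRight Y ∧ (pairing X J).re < (pairing Y J).re := by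
  classical
  -- With the sign in the second component, membership is exactly the excluded sandwich.
  have hnot : (J, -J) ∉ dominatingCone A B μ := by
    rintro ⟨σ, hσ, h1, h2⟩
    exact h ⟨σ, hσ, h1, by simpa [neg_add_eq_sub] using h2⟩
  have := locallyConvexSpace_op (n := B × A)
  obtain ⟨f, u, hfu, hK⟩ := RCLike.geometric_hahn_banach_point_closed (𝕜 := ℂ)
    (convex_dominatingCone μ) (isClosed_dominatingCone hμ) hnot
  have hcone : ∀ z ∈ dominatingCone A B μ, 0 ≤ (f z).re := by
    rintro z ⟨σ, hσ, h1, h2⟩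
    -- The set is a cone, so a negative value could be scaled to `-|u|`, which is not above the
    -- separating level `u`.
    by_contra! hneg
    have hmem : ∀ c : ℝ, 0 ≤ c → (c : ℂ) • z ∈ dominatingCone A B μ := by
      intro c hc
      refine ⟨(c : ℂ) • σ, hσ.smul (by simp [IsSelfAdjoint]), ?_, ?_⟩
      · convert PosSemidef.real_smul h1 hc using 1
        simp only [Prod.smul_fst, Matrix.smul_kronecker]
        module
      · convert PosSemidef.real_smul h2 hc using 1
        simp only [Prod.smul_snd, Matrix.smul_kronecker]
        module
    have h3 := hK _ (hmem (|u| / -(f z).re) (by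
      have : 0 < -(f z).re := by linarith
      positivity))
    rw [map_smul, smul_eq_mul] at h3
    have h4 : RCLike.re (((|u| / -(f z).re : ℝ) : ℂ) * f z) = |u| / -(f z).re * (f z).re :=
      Complex.re_ofReal_mul _ _
    rw [h4, div_mul_eq_mul_div, div_neg, mul_div_assoc, div_self hneg.ne, mul_one] at h3
    linarith [neg_abs_le u]
  have hu : u < 0 := by
    have := hK 0 ⟨0, Matrix.isHermitian_zero, by simpa using Matrix.PosSemidef.zero,
      by simpa using Matrix.PosSemidef.zero⟩
    simpa using this
  let f₁ : Op (B × A) →ₗ[ℂ] ℂ := f.toLinearMap ∘ₗ LinearMap.inl ℂ _ _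
  let f₂ : Op (B × A) →ₗ[ℂ] ℂ := f.toLinearMap ∘ₗ LinearMap.inr ℂ _ _
  have hf : ∀ P Q, f (P, Q) = f₁ P + f₂ Q := by
    intro P Q
    have : (P, Q) = (P, 0) + (0, Q) := by simp
    rw [this, map_add]; rfl
  obtain ⟨X, hX, hXf⟩ := exists_hermitian_pairing f₁
  obtain ⟨Y, hY, hYf⟩ := exists_hermitian_pairing f₂
  have hXr : ∀ P : Op (B × A), P.IsHermitian → (f₁ P).re = (pairing X P).re := fun P hP => by
    rw [← hXf P hP, Complex.ofReal_re]
  have hYr : ∀ P : Op (B × A), P.IsHermitian → (f₂ P).re = (pairing Y P).re := fun P hP => by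
    rw [← hYf P hP, Complex.ofReal_re]
  refine ⟨X, Y, posSemidef_of_pairing hX fun P hP => ?_, posSemidef_of_pairing hY fun P hP => ?_,
    ?_, ?_⟩
  · rw [← hXr P hP.1]
    have := hcone (P, 0) ⟨0, Matrix.isHermitian_zero, by simpa using hP,
      by simpa using Matrix.PosSemidef.zero⟩
    rwa [hf, map_zero, add_zero] at this
  · rw [← hYr P hP.1]
    have := hcone (0, P) ⟨0, Matrix.isHermitian_zero, by simpa using Matrix.PosSemidef.zero,
      by simpa using hP⟩
    rwa [hf, map_zero, zero_add] at this
  · set T : Op B := traceRight X - (μ : ℂ) • traceRight Y with hT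
    have htr : ∀ {Z : Op (B × A)}, Z.IsHermitian → (traceRight Z).IsHermitian := by
      intro Z hZ
      refine Matrix.IsHermitian.ext fun b b' => ?_
      simp only [traceRight, Matrix.of_apply, star_sum]
      exact Finset.sum_congr rfl fun a _ => hZ.apply _ _
    have hTh : T.IsHermitian := (htr hX).sub ((htr hY).smul (by simp [IsSelfAdjoint]))
    -- The pairs `(σ ⊗ 1, -μ σ ⊗ 1)` form a real subspace inside the cone, on which the functional
    -- must vanish.
    have hval : ∀ σ : Op B, σ.IsHermitian → 0 ≤ (pairing T σ).re := by
      intro σ hσ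
      have h0 := hcone (σ ⊗ₖ (1 : Op A), -((μ : ℂ) • (σ ⊗ₖ (1 : Op A))))
        ⟨σ, hσ, by simpa using Matrix.PosSemidef.zero, by simpa using Matrix.PosSemidef.zero⟩
      rw [hf, map_neg, map_smul, Complex.add_re, Complex.neg_re, smul_eq_mul,
        Complex.re_ofReal_mul, hXr _ (kronecker_one_isHermitian hσ),
        hYr _ (kronecker_one_isHermitian hσ), pairing_kronecker_one, pairing_kronecker_one] at h0
      have : pairing T σ = pairing (traceRight X) σ - (μ : ℂ) * pairing (traceRight Y) σ := by
        rw [hT, sub_eq_add_neg, ← neg_smul, pairing_add_left, pairing_smul_left]; ring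
      rw [this, Complex.sub_re, Complex.re_ofReal_mul]
      linarith
    -- This test evaluates to minus the squared Frobenius norm of `T`.
    have h0 := hval (-T.transpose) hTh.transpose.neg
    have h1 : pairing T (-T.transpose) = -(∑ p, ∑ q, (‖T p q‖ ^ 2 : ℝ)) := by
      rw [pairing_eq_sum]
      push_cast
      rw [← Finset.sum_neg_distrib]
      refine Finset.sum_congr rfl fun p _ => ?_
      rw [← Finset.sum_neg_distrib]
      refine Finset.sum_congr rfl fun q _ => ?_
      have hpq : T q p = star (T p q) := (hTh.apply q p).symm
      change T p q * -T q p = -(‖T p q‖ : ℂ) ^ 2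
      rw [hpq, mul_neg, Complex.star_def, Complex.mul_conj, Complex.normSq_eq_norm_sq]
      push_cast
      rfl
    rw [h1, ← Complex.ofReal_neg, Complex.ofReal_re] at h0
    have h2 : ∑ p, ∑ q, (‖T p q‖ ^ 2 : ℝ) = 0 :=
      le_antisymm (by linarith) (Finset.sum_nonneg fun _ _ => Finset.sum_nonneg fun _ _ => by
        positivity)
    refine sub_eq_zero.1 ?_
    ext p q
    have h3 := (Finset.sum_eq_zero_iff_of_nonneg fun _ _ => Finset.sum_nonneg fun _ _ => by
      positivity).1 h2 p (Finset.mem_univ _)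
    have h4 := (Finset.sum_eq_zero_iff_of_nonneg fun _ _ => by positivity).1 h3 q
      (Finset.mem_univ _)
    exact norm_eq_zero.1 ((pow_eq_zero_iff two_ne_zero).1 h4)
  · have h3 : (f (J, -J)).re < 0 := lt_trans hfu hu
    rw [hf, map_neg, Complex.add_re, Complex.neg_re, hXr J hJ.1, hYr J hJ.1] at h3
    linarith

end Duality

/-! ### Building blocks of the postselected protocol. -/

section Components

variable {A B K L : Type*} [Fintype A] [Fintype B] [Fintype K] [Fintype L]

/-- The probability of a measurement outcome `Q`. -/
noncomputable def outcome (Q : Op L) : SuperOp L Unit :=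
  (Matrix.traceLinearMap L ℂ ℂ ∘ₗ LinearMap.mulLeft ℂ Q).smulRight 1

theorem outcome_apply (Q X : Op L) : outcome Q X = (Q * X).trace • 1 := rfl

theorem isCP_outcome {Q : Op L} (hQ : Q.PosSemidef) : IsCP (outcome Q) := by
  classical
  apply isCP_of_choi
  have h : choi (outcome Q) = Q.transpose.submatrix Prod.snd Prod.snd := by
    ext p q
    simp [choi, outcome_apply, Matrix.trace_mul_single]
  rw [h]
  exact hQ.transpose.submatrix _

theorem trace_outcome (Q X : Op L) : (outcome Q X).trace = (Q * X).trace := by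
  simp [outcome_apply]

/-- The linear map with a given Choi operator. -/
noncomputable def ofChoi (X : Op (B × A)) : SuperOp B A where
  toFun Z := Matrix.of fun a a' => ∑ b, ∑ b', Z b b' * X (b, a) (b', a')
  map_add' Y Z := by
    ext
    simp [add_mul, Finset.sum_add_distrib]
  map_smul' c Z := by
    ext
    simp [mul_assoc, Finset.mul_sum]

theorem ofChoi_apply (X : Op (B × A)) (Z : Op B) (a a' : A) :
    ofChoi X Z a a' = ∑ b, ∑ b', Z b b' * X (b, a) (b', a') := rfl

theorem ofChoi_single [DecidableEq B] (X : Op (B × A)) (b b' : B) (a a' : A) :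
    ofChoi X (Matrix.single b b' 1) a a' = X (b, a) (b', a') := by
  simp [ofChoi_apply, Matrix.single_apply, ite_and]

theorem isChannel_ofChoi [DecidableEq B] {X : Op (B × A)} (hX : X.PosSemidef)
    (h1 : traceRight X = 1) : IsChannel (ofChoi X) := by
  constructor
  · apply isCP_of_choi
    convert hX.submatrix (Prod.swap : A × B → B × A) using 1
    ext p q
    exact ofChoi_single X p.2 q.2 p.1 q.1
  · intro Z
    have h : ∀ b b', ∑ a, X (b, a) (b', a) = if b = b' then 1 else 0 := fun b b' => by
      rw [← Matrix.one_apply, ← h1]; rfl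
    calc (ofChoi X Z).trace = ∑ b, ∑ b', Z b b' * ∑ a, X (b, a) (b', a) := by
          simp only [Matrix.trace, Matrix.diag, ofChoi_apply, Finset.mul_sum]
          rw [Finset.sum_comm]
          exact Finset.sum_congr rfl fun b _ => Finset.sum_comm
      _ = Z.trace := by simp [h, Matrix.trace]

/-- With `G = Cᴴ C`, conjugating by the inverse of `S = Cᴴ` normalizes the marginal. It matters that
`S` depends on `G` alone: Bob undoes the normalization without knowing which of the two channels
Alice applied. -/
theorem exists_normalization [DecidableEq B] [DecidableEq A] {G : Op B} (hG : G.PosDef) :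
    ∃ S : Op B, ∀ X : Op (B × A), X.PosSemidef → traceRight X = G →
      ∃ Y : Op (B × A), Y.PosSemidef ∧ traceRight Y = 1 ∧
        X = (S ⊗ₖ (1 : Op A)) * Y * (S ⊗ₖ (1 : Op A)).conjTranspose := by
  obtain ⟨C, hC⟩ := exists_eq_conjTranspose_mul_self hG.posSemidef
  have hCu : IsUnit C.det := by
    have := (Matrix.isUnit_iff_isUnit_det _).1 hG.isUnit
    rw [hC, Matrix.det_mul] at this
    exact isUnit_of_mul_isUnit_right this
  have hS : C.conjTranspose * C⁻¹.conjTranspose = 1 := by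
    rw [← Matrix.conjTranspose_mul, Matrix.nonsing_inv_mul _ hCu, Matrix.conjTranspose_one]
  have hS' : C⁻¹.conjTranspose * C.conjTranspose = 1 := by
    rw [← Matrix.conjTranspose_mul, Matrix.mul_nonsing_inv _ hCu, Matrix.conjTranspose_one]
  refine ⟨C.conjTranspose, fun X hX hXG => ⟨(C⁻¹.conjTranspose ⊗ₖ (1 : Op A)) * X *
    (C⁻¹.conjTranspose ⊗ₖ (1 : Op A)).conjTranspose, hX.mul_mul_conjTranspose_same _, ?_, ?_⟩⟩
  · have : ∀ T : Op B, traceRight ((T ⊗ₖ (1 : Op A)) * X * (T ⊗ₖ (1 : Op A)).conjTranspose) =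
        T * traceRight X * T.conjTranspose := by
      intro T
      ext b b'
      simp only [traceRight, Matrix.of_apply, Matrix.mul_apply, Fintype.sum_prod_type,
        Matrix.kroneckerMap_apply, Matrix.conjTranspose_apply, Matrix.one_apply, mul_ite, mul_one,
        mul_zero, ite_mul, zero_mul, apply_ite star, star_zero, Finset.sum_ite_eq,
        Finset.mem_univ, if_true, Finset.sum_mul, Finset.mul_sum]
      rw [Finset.sum_comm]
      refine Finset.sum_congr rfl fun b₁ _ => ?_
      rw [Finset.sum_comm]
    rw [this, hXG, hC, Matrix.conjTranspose_conjTranspose, ← Matrix.mul_assoc, hS',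
      Matrix.one_mul, Matrix.mul_nonsing_inv _ hCu]
  · rw [← Matrix.mul_assoc, ← Matrix.mul_assoc, ← Matrix.mul_kronecker_mul, hS, Matrix.mul_one,
      Matrix.one_kronecker_one, Matrix.one_mul, Matrix.mul_assoc, ← Matrix.conjTranspose_mul,
      ← Matrix.mul_kronecker_mul, hS, Matrix.mul_one, Matrix.one_kronecker_one,
      Matrix.conjTranspose_one, Matrix.mul_one]

end Components

section Loop

variable {A B M : Type*} [Fintype A] [Fintype B] [Fintype M] [DecidableEq M]

/-- Alice compares her message with her half of the shared entangled state, and applies `F₁` or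
`F₂` to the other shared system, according to the outcome `Q` or `1 - Q`. -/
noncomputable def compareEncoder (Q : Op (M × M)) (F₁ F₂ : SuperOp B A) :
    SuperOp ((B × M) × M) A :=
  (F₁ ∘ₗ reindexMap (fun b : B => (b, ())) ∘ₗ ampl B (outcome Q) +
    F₂ ∘ₗ reindexMap (fun b : B => (b, ())) ∘ₗ ampl B (outcome (1 - Q))) ∘ₗ
      reindexMap (Equiv.prodAssoc B M M).symm

theorem isChannel_compareEncoder {Q : Op (M × M)} (hQ : Q.PosSemidef) (hQ' : (1 - Q).PosSemidef)
    {F₁ F₂ : SuperOp B A} (h₁ : IsChannel F₁) (h₂ : IsChannel F₂) :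
    IsChannel (compareEncoder Q F₁ F₂) := by
  refine IsChannel.comp ⟨?_, fun X => ?_⟩ (isChannel_reindexMap _)
  · exact (h₁.1.comp ((isCP_reindexMap _).comp (isCP_outcome hQ).ampl)).add
      (h₂.1.comp ((isCP_reindexMap _).comp (isCP_outcome hQ').ampl))
  · have hr : ∀ Z : Op (B × Unit), (reindexMap (fun b : B => (b, ())) Z).trace = Z.trace :=
      fun Z => trace_reindexMap (Equiv.prodPUnit B).symm Z
    rw [LinearMap.add_apply, Matrix.trace_add]
    simp only [LinearMap.comp_apply]
    rw [h₁.2, h₂.2, hr, hr, trace_ampl, trace_ampl, ← Finset.sum_add_distrib, trace_eq_sum_block]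
    refine Finset.sum_congr rfl fun b _ => ?_
    rw [trace_outcome, trace_outcome, ← Matrix.trace_add, ← Matrix.add_mul, add_sub_cancel,
      Matrix.one_mul]

theorem compareEncoder_single [DecidableEq B] (Q : Op (M × M)) (F₁ F₂ : SuperOp B A) (p q : B × M)
    (ρ : Op M) : compareEncoder Q F₁ F₂ (Matrix.single p q 1 ⊗ₖ ρ) =
      (Q * (Matrix.single p.2 q.2 1 ⊗ₖ ρ)).trace • F₁ (Matrix.single p.1 q.1 1) +
      ((1 - Q) * (Matrix.single p.2 q.2 1 ⊗ₖ ρ)).trace • F₂ (Matrix.single p.1 q.1 1) := by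
  have h : ∀ Q : Op (M × M), reindexMap (fun b : B => (b, ())) (ampl B (outcome Q)
      (reindexMap (Equiv.prodAssoc B M M).symm (Matrix.single p q (1 : ℂ) ⊗ₖ ρ))) =
      (Q * (Matrix.single p.2 q.2 1 ⊗ₖ ρ)).trace • Matrix.single p.1 q.1 1 := by
    intro Q
    ext b b'
    have hb : block b b' (reindexMap (Equiv.prodAssoc B M M).symm
        (Matrix.single p q (1 : ℂ) ⊗ₖ ρ)) =
        Matrix.single p.1 q.1 (1 : ℂ) b b' • (Matrix.single p.2 q.2 1 ⊗ₖ ρ) := by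
      ext x y
      obtain ⟨p1, p2⟩ := p
      obtain ⟨q1, q2⟩ := q
      simp only [block_apply, reindexMap_apply, Matrix.kroneckerMap_apply, Matrix.smul_apply,
        smul_eq_mul, Equiv.prodAssoc_symm_apply, Matrix.single_apply, Prod.mk.injEq]
      by_cases h1 : p1 = b <;> by_cases h2 : q1 = b' <;> simp [h1, h2]
    rw [reindexMap_apply, ampl_apply, hb, outcome_apply]
    simp [mul_comm]
  simp only [compareEncoder, LinearMap.comp_apply, LinearMap.add_apply, h, map_smul]

/-- Bob projects the channel output onto the shared system, and keeps the other shared system. -/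
noncomputable def loopDecoder (M : Type*) [Fintype M] [DecidableEq M] (S : Op B) :
    SuperOp ((B × M) × B) M :=
  conjMap (Matrix.of fun m p => if m = p.1.2 then S p.2 p.1.1 else 0)

theorem loopDecoder_apply (S : Op B) (W : Op ((B × M) × B)) (m m' : M) :
    loopDecoder M S W m m' = ∑ b, ∑ b', ∑ b₁, ∑ b₁',
      S b b₁ * star (S b' b₁') * W ((b₁, m), b) ((b₁', m'), b') := by
  simp only [loopDecoder, conjMap_apply, Matrix.mul_apply, Fintype.sum_prod_type, Matrix.of_apply,
    Matrix.conjTranspose_apply, ite_mul, zero_mul, apply_ite star, star_zero, mul_ite, mul_zero,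
    Finset.sum_mul, Finset.sum_ite_irrel, Finset.sum_const_zero, Finset.sum_ite_eq,
    Finset.mem_univ, if_true]
  simp only [← Fintype.sum_prod_type']
  exact Fintype.sum_equiv ⟨fun x => (x.2.2.2, x.2.1, x.2.2.1, x.1),
    fun x => (x.2.2.2, x.2.1, x.2.2.1, x.1), fun _ => rfl, fun _ => rfl⟩ _ _ fun x => by
      simp only [Equiv.coe_fn_mk]; ring

theorem conj_kronecker_one_apply [DecidableEq A] (S : Op B) (Y : Op (B × A)) (b b' : B)
    (a a' : A) : ((S ⊗ₖ (1 : Op A)) * Y * (S ⊗ₖ (1 : Op A)).conjTranspose) (b, a) (b', a') =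
      ∑ b₁, ∑ b₁', S b b₁ * star (S b' b₁') * Y (b₁, a) (b₁', a') := by
  simp only [Matrix.mul_apply, Fintype.sum_prod_type, Matrix.kroneckerMap_apply,
    Matrix.conjTranspose_apply, Matrix.one_apply, mul_ite, mul_one, mul_zero, ite_mul, zero_mul,
    apply_ite star, star_zero, Finset.sum_ite_eq, Finset.mem_univ, if_true, Finset.sum_mul]
  rw [Finset.sum_comm]
  exact Finset.sum_congr rfl fun b₁ _ => Finset.sum_congr rfl fun b₁' _ => by ring

/-- Bob's projection feeds the output of `N` back into the channel `ofChoi Y`; the value of the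
closed loop is a pairing of Choi operators. -/
theorem sum_loop [DecidableEq A] [DecidableEq B] (S : Op B) (N : SuperOp A B) (Y : Op (B × A)) :
    ∑ b, ∑ b', ∑ b₁, ∑ b₁', S b b₁ * star (S b' b₁') *
      N (ofChoi Y (Matrix.single b₁ b₁' 1)) b b' =
    pairing ((S ⊗ₖ (1 : Op A)) * Y * (S ⊗ₖ (1 : Op A)).conjTranspose) (choi N) := by
  simp only [apply_eq_sum_choi N, ofChoi_single, pairing_eq_sum, Fintype.sum_prod_type,
    conj_kronecker_one_apply, Finset.sum_mul, Finset.mul_sum]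
  refine Finset.sum_congr rfl fun b _ => ?_
  conv_rhs => rw [Finset.sum_comm]
  refine Finset.sum_congr rfl fun b' _ => ?_
  simp only [← Fintype.sum_prod_type']
  exact Fintype.sum_equiv ⟨fun x => (x.2.2.1, x.2.2.2, x.1, x.2.1),
    fun x => (x.2.2.1, x.2.2.2, x.1, x.2.1), fun _ => rfl, fun _ => rfl⟩ _ _ fun x => by
      simp only [Equiv.coe_fn_mk]; ring

theorem trace_maxEnt_mul (ρ : Op M) (m m' : M) :
    (maxEnt (Equiv.refl M) * (Matrix.single m m' 1 ⊗ₖ ρ)).trace =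
      (Fintype.card M : ℂ)⁻¹ * ρ m m' := by
  simp only [Matrix.trace, Matrix.diag, Matrix.mul_apply, Fintype.sum_prod_type, maxEnt_apply,
    Matrix.kroneckerMap_apply, Matrix.single_apply, Equiv.refl_apply]
  simp only [ite_and, ite_mul, one_mul, zero_mul, mul_ite, mul_zero, Finset.sum_ite_irrel,
    Finset.sum_const_zero, Finset.sum_ite_eq, Finset.mem_univ, if_true]
  rw [Finset.sum_eq_single m' (fun x _ hx => by simp [hx.symm]) (by simp),
    Finset.sum_eq_single m (fun x _ hx => by simp [hx.symm]) (by simp)]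
  simp

end Loop

/-! ### The protocol and the map it simulates. -/

section Protocol

variable {A B M : Type*} [Fintype A] [Fintype B] [Fintype M]

theorem trace_one_sub_maxEnt_mul [DecidableEq M] (ρ : Op M) (m m' : M) :
    ((1 - maxEnt (Equiv.refl M)) * (Matrix.single m m' 1 ⊗ₖ ρ)).trace =
      (if m = m' then ρ.trace else 0) - (Fintype.card M : ℂ)⁻¹ * ρ m m' := by
  rw [Matrix.sub_mul, Matrix.trace_sub, trace_maxEnt_mul, Matrix.one_mul, Matrix.trace_kronecker]
  split_ifs with h
  · simp [h]
  · simp [Matrix.trace_single_eq_of_ne, h]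

/-- The shared state is maximally entangled on two copies of `B × M`. Alice's outcome `Φ` on message
and `M`-half teleports `ρ` without correction; the complementary outcome leaves the rest of `Tr[ρ]
1`. Each branch is weighted by the loop through `N` that her choice of channel opens. -/
theorem exists_isPEA [DecidableEq A] {d : ℕ} (hd : 0 < d) (N : SuperOp A B) {X Y : Op (B × A)}
    (hX : X.PosSemidef) (hY : Y.PosSemidef) (hXY : traceRight X = traceRight Y)
    (hpos : (traceRight Y).PosDef) [Nonempty B] :
    ∃ (Θ : Supermap A B (Fin d) (Fin d)) (c : ℝ), IsPEA Θ ∧ 0 < c ∧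
      ∀ ρ m m', Θ N ρ m m' = c *
        ((d : ℂ)⁻¹ * ρ m m' * pairing X (choi N) +
          ((if m = m' then ρ.trace else 0) - (d : ℂ)⁻¹ * ρ m m') * pairing Y (choi N)) := by
  classical
  have : Nonempty (Fin d) := ⟨⟨0, hd⟩⟩
  obtain ⟨S, hS⟩ := exists_normalization (A := A) hpos
  obtain ⟨X', hX', hX1, hXS⟩ := hS X hX hXY
  obtain ⟨Y', hY', hY1, hYS⟩ := hS Y hY rfl
  let n := Fintype.card (B × Fin d)
  let e : Fin n ≃ B × Fin d := (Fintype.equivFin _).symm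
  have : Nonempty (Fin n) := e.nonempty
  let γ : Op (Fin n × Fin n) := maxEnt (Equiv.refl (Fin n))
  let E : SuperOp (Fin n × Fin d) A :=
    compareEncoder (maxEnt (Equiv.refl (Fin d))) (ofChoi X') (ofChoi Y') ∘ₗ
      reindexMap (Equiv.prodCongr e (Equiv.refl (Fin d))).symm
  have hE : IsChannel E := (isChannel_compareEncoder (maxEnt_posSemidef _)
    (one_sub_pure_posSemidef (isPureState_maxEnt _)) (isChannel_ofChoi hX' hX1)
    (isChannel_ofChoi hY' hY1)).comp (isChannel_reindexMap _)
  let D₀ : SuperOp (Fin n × B) (Fin d) :=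
    loopDecoder (Fin d) S ∘ₗ reindexMap (Equiv.prodCongr e (Equiv.refl B)).symm
  have hD₀ : IsCP D₀ := (isCP_conjMap _).comp (isCP_reindexMap _)
  obtain ⟨c, hc, hD⟩ := hD₀.exists_isSubchannel_smul
  have hγ : IsState γ := isState_maxEnt _
  -- The factor `c` makes Bob's filter trace nonincreasing, and `n⁻¹` comes from the entries of the
  -- shared state. Conditioning on success cancels both.
  refine ⟨comb ((c : ℂ) • D₀) (encoder γ E), c * (n : ℝ)⁻¹,
    ⟨isProbSupermap_comb hD (isChannel_encoder hγ hE).isSubchannel, n, n, γ, E, (c : ℂ) • D₀, hγ,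
      hE, hD, fun N ρ => rfl⟩, ?_, fun ρ m m' => ?_⟩
  · have : 0 < n := Fin.pos_iff_nonempty.2 inferInstance
    positivity
  · have hblock : ∀ b₁ b₁', E (block (e.symm (b₁, m)) (e.symm (b₁', m'))
        (reindexMap (Equiv.prodAssoc (Fin n) (Fin n) (Fin d)).symm (adjoin (Fin d) γ ρ))) =
        (n : ℂ)⁻¹ • (((d : ℂ)⁻¹ * ρ m m') • ofChoi X' (Matrix.single b₁ b₁' 1) +
          ((if m = m' then ρ.trace else 0) - (d : ℂ)⁻¹ * ρ m m') •
            ofChoi Y' (Matrix.single b₁ b₁' 1)) := by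
      intro b₁ b₁'
      have h1 : reindexMap (Equiv.prodCongr e (Equiv.refl (Fin d))).symm
          (block (e.symm (b₁, m)) (e.symm (b₁', m'))
          (reindexMap (Equiv.prodAssoc (Fin n) (Fin n) (Fin d)).symm (adjoin (Fin d) γ ρ))) =
          (n : ℂ)⁻¹ • (Matrix.single (b₁, m) (b₁', m') 1 ⊗ₖ ρ) := by
        ext ⟨p, x⟩ ⟨q, y⟩
        have h2 : reindexMap (Equiv.prodCongr e (Equiv.refl (Fin d))).symm
          (block (e.symm (b₁, m)) (e.symm (b₁', m'))
          (reindexMap (Equiv.prodAssoc (Fin n) (Fin n) (Fin d)).symm (adjoin (Fin d) γ ρ)))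
            (p, x) (q, y) = maxEnt (Equiv.refl (Fin n)) (e.symm (b₁, m), e.symm p)
              (e.symm (b₁', m'), e.symm q) * ρ x y := rfl
        rw [h2, maxEnt_apply]
        simp only [Equiv.refl_apply, EmbeddingLike.apply_eq_iff_eq, Matrix.smul_apply,
          Matrix.kroneckerMap_apply, Matrix.single_apply, Fintype.card_fin, smul_eq_mul]
        split_ifs <;> simp
      change compareEncoder (maxEnt (Equiv.refl (Fin d))) (ofChoi X') (ofChoi Y')
        (reindexMap _ _) = _
      rw [h1, map_smul, compareEncoder_single, trace_maxEnt_mul, trace_one_sub_maxEnt_mul,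
        Fintype.card_fin]
    have hW : comb ((c : ℂ) • D₀) (encoder γ E) N ρ m m' = c * ∑ b, ∑ b', ∑ b₁, ∑ b₁',
        S b b₁ * star (S b' b₁') * N (E (block (e.symm (b₁, m)) (e.symm (b₁', m'))
        (reindexMap (Equiv.prodAssoc (Fin n) (Fin n) (Fin d)).symm (adjoin (Fin d) γ ρ)))) b b' :=
      congrArg (fun z => (c : ℂ) * z) (loopDecoder_apply S _ m m')
    rw [hW, hXS, hYS, ← sum_loop, ← sum_loop]
    simp only [hblock, map_smul, map_add, Matrix.smul_apply, Matrix.add_apply, smul_eq_mul]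
    push_cast
    simp only [Finset.mul_sum, ← Finset.sum_add_distrib]
    refine Finset.sum_congr rfl fun b _ => Finset.sum_congr rfl fun b' _ =>
      Finset.sum_congr rfl fun b₁ _ => Finset.sum_congr rfl fun b₁' _ => ?_
    ring

end Protocol

/-! ### Worst-case conditional fidelity of the simulated map. -/

section Fidelity

variable {M K : Type*} [Fintype M] [Fintype K]

theorem isCP_smul_replacer_one_sub_id [DecidableEq M] [Nonempty M] :
    IsCP ((Fintype.card M : ℂ) • replacer M (1 : Op M) - LinearMap.id) := by
  apply isCP_of_maxEnt (Equiv.refl M)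
  have h : ampl M ((Fintype.card M : ℂ) • replacer M (1 : Op M) - LinearMap.id)
      (maxEnt (Equiv.refl M)) = 1 - maxEnt (Equiv.refl M) := by
    have h0 : (Fintype.card M : ℂ) ≠ 0 := by simp
    ext p q
    simp only [ampl_apply, LinearMap.sub_apply, LinearMap.smul_apply, LinearMap.id_apply,
      replacer_apply, Matrix.sub_apply, Matrix.smul_apply, smul_eq_mul,
      block_maxEnt, Matrix.trace_smul, Equiv.refl_apply, Matrix.one_apply]
    by_cases h : p.1 = q.1
    · simp [h, Prod.ext_iff, h0, maxEnt_apply, Matrix.single_apply]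
    · simp [h, Matrix.trace_single_eq_of_ne, Prod.ext_iff, maxEnt_apply, Matrix.single_apply]
      congr
  rw [h]
  exact one_sub_pure_posSemidef (isPureState_maxEnt _)

theorem IsPureState.mul_self {ψ : Op M} (hψ : IsPureState ψ) : ψ * ψ = ψ := by
  obtain ⟨v, hv, rfl⟩ := hψ
  rw [Matrix.vecMulVec_mul_vecMulVec, hv]; simp

theorem IsPureState.trace {ψ : Op M} (hψ : IsPureState ψ) : ψ.trace = 1 := by
  obtain ⟨v, hv, rfl⟩ := hψ
  rw [Matrix.trace_vecMulVec, dotProduct_comm, hv]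

/-- Test `ψ ≤ d (ψ_R ⊗ 1)` against `ψ` itself. This is what makes the maximally entangled input the
worst case in `quantumError_le`. -/
theorem one_le_card_mul_trace [DecidableEq M] [Nonempty M] {ψ : Op (K × M)} (hψ : IsPureState ψ) :
    1 ≤ (Fintype.card M : ℝ) * (ψ * (traceRight ψ ⊗ₖ (1 : Op M))).trace.re := by
  have h := trace_mul_nonneg hψ.posSemidef
    ((isCP_smul_replacer_one_sub_id (M := M)).ampl_posSemidef (K := K) hψ.posSemidef)
  have h1 : ampl K ((Fintype.card M : ℂ) • replacer M (1 : Op M) - LinearMap.id) ψ =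
      (Fintype.card M : ℂ) • (traceRight ψ ⊗ₖ (1 : Op M)) - ψ := by
    rw [← ampl_replacer]; rfl
  rw [h1, Matrix.mul_sub, hψ.mul_self, Matrix.trace_sub, hψ.trace, Matrix.mul_smul,
    Matrix.trace_smul, smul_eq_mul] at h
  have h2 := (Complex.le_def.1 h).1
  rw [Complex.zero_re, Complex.sub_re, ← Complex.ofReal_natCast, Complex.re_ofReal_mul,
    Complex.one_re] at h2
  linarith

/-- The map combines the identity and the depolarizing map, so its output trace is the same for all
`ψ`, and the fidelity is at least `x / (x + (d² - 1) y)`. -/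
theorem quantumError_le {d : ℕ} (hd : 0 < d) {N : SuperOp (Fin d) (Fin d)} {c x y ε : ℝ}
    (hc : 0 < c) (hx : 0 < x) (hy : 0 ≤ y) (hε1 : ε < 1)
    (hxy : ((d : ℝ) ^ 2 - 1) * y ≤ ε / (1 - ε) * x)
    (hN : ∀ ρ m m', N ρ m m' = c * ((d : ℂ)⁻¹ * ρ m m' * x +
      ((if m = m' then ρ.trace else 0) - (d : ℂ)⁻¹ * ρ m m') * y)) : quantumError N ≤ ε := by
  have : Nonempty (Fin d) := ⟨⟨0, hd⟩⟩
  have hdr : (0 : ℝ) < d := by exact_mod_cast hd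
  have hN' : N = ((c * ((x - y) / d) : ℝ) : ℂ) • LinearMap.id +
      ((c * y : ℝ) : ℂ) • replacer (Fin d) (1 : Op (Fin d)) := by
    ext ρ m m'
    rw [hN]
    simp only [LinearMap.add_apply, LinearMap.smul_apply, LinearMap.id_apply, replacer_apply,
      Matrix.add_apply, Matrix.smul_apply, smul_eq_mul, Matrix.one_apply, mul_ite, mul_one,
      mul_zero]
    push_cast
    split_ifs <;> ring
  have key : ∀ f ∈ {f : ℝ | ∃ (r : ℕ) (ψ : Op (Fin r × Fin d)), IsPureState ψ ∧
      f = condFidelity N ψ}, 1 - ε ≤ f := by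
    rintro _ ⟨r, ψ, hψ, rfl⟩
    have h1 : ampl (Fin r) N ψ = ((c * ((x - y) / d) : ℝ) : ℂ) • ψ +
        ((c * y : ℝ) : ℂ) • (traceRight ψ ⊗ₖ (1 : Op (Fin d))) := by
      rw [← ampl_replacer, hN']; rfl
    have htr : (traceRight ψ).trace = 1 := by
      rw [← hψ.trace, trace_eq_sum_block]; rfl
    have hτ := one_le_card_mul_trace hψ
    rw [Fintype.card_fin] at hτ
    unfold condFidelity
    rw [h1, Matrix.mul_add, Matrix.mul_smul, Matrix.mul_smul, hψ.mul_self]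
    simp only [Matrix.trace_add, Matrix.trace_smul, smul_eq_mul, Complex.add_re,
      Complex.re_ofReal_mul, hψ.trace, Matrix.trace_kronecker, htr, Matrix.trace_one,
      Fintype.card_fin, one_mul, mul_one, Complex.natCast_re, Complex.ofReal_re]
    set τ := (ψ * (traceRight ψ ⊗ₖ (1 : Op (Fin d)))).trace.re
    have hd1 : (1 : ℝ) ≤ d := by exact_mod_cast hd
    have hpos : 0 < c * ((x - y) / d) + c * y * d := by
      have : c * ((x - y) / d) + c * y * d = c * (x + ((d : ℝ) ^ 2 - 1) * y) / d := by
        field_simp; ring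
      rw [this]
      have : 0 ≤ ((d : ℝ) ^ 2 - 1) * y := mul_nonneg (by nlinarith) hy
      positivity
    rw [le_div_iff₀ hpos]
    rw [div_mul_eq_mul_div, le_div_iff₀ (by linarith)] at hxy
    have e1 : (1 - ε) * (c * ((x - y) / d) + c * y * d) * d =
        c * ((1 - ε) * x + ((d : ℝ) ^ 2 - 1) * y * (1 - ε)) := by
      field_simp; ring
    have e2 : (c * ((x - y) / d) + c * y * τ) * d = c * (x - y + y * (d * τ)) := by
      field_simp
    refine le_of_mul_le_mul_right ?_ hdr
    rw [e1, e2]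
    refine mul_le_mul_of_nonneg_left ?_ hc.le
    nlinarith [mul_le_mul_of_nonneg_left hτ hy]
  unfold quantumError
  -- Needed because the real infimum of the empty set is `0`.
  have hne : {f : ℝ | ∃ (r : ℕ) (ψ : Op (Fin r × Fin d)), IsPureState ψ ∧
      f = condFidelity N ψ}.Nonempty :=
    ⟨_, d, _, isPureState_maxEnt (Equiv.refl (Fin d)), rfl⟩
  linarith [le_csInf hne key]

end Fidelity

/-! ### From a dual witness to a protocol. -/

section Achievability

variable {A B : Type*} [Fintype A] [Fintype B] [Nonempty A] [Nonempty B]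

theorem exists_isPEA_quantumError_le [DecidableEq A] {d : ℕ} (hd : 0 < d) {N : SuperOp A B}
    {X Y : Op (B × A)} (hN : IsCP N) (hX : X.PosSemidef) (hY : Y.PosSemidef)
    (hXY : traceRight X = traceRight Y) (hpos : (traceRight Y).PosDef) {ε : ℝ}
    (hε1 : ε < 1) (hx : 0 < (pairing X (choi N)).re)
    (hxy : ((d : ℝ) ^ 2 - 1) * (pairing Y (choi N)).re ≤ ε / (1 - ε) * (pairing X (choi N)).re) :
    ∃ Θ : Supermap A B (Fin d) (Fin d), IsPEA Θ ∧ quantumError (Θ N) ≤ ε := by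
  obtain ⟨Θ, c, hΘ, hc, h⟩ := exists_isPEA hd N hX hY hXY hpos
  have hr : ∀ {Z : Op (B × A)}, Z.PosSemidef →
      pairing Z (choi N) = ((pairing Z (choi N)).re : ℂ) := fun hZ =>
    Complex.eq_re_of_ofReal_le (r := 0) (by simpa using pairing_nonneg hZ hN.choi_posSemidef)
  have hy : 0 ≤ (pairing Y (choi N)).re :=
    (Complex.le_def.1 (pairing_nonneg hY hN.choi_posSemidef)).1
  refine ⟨Θ, hΘ, quantumError_le hd hc hx hy hε1 hxy fun ρ m m' => ?_⟩
  rw [← hr hX, ← hr hY]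
  exact h ρ m m'

theorem traceRight_one [DecidableEq A] [DecidableEq B] :
    traceRight (1 : Op (B × A)) = (Fintype.card A : ℂ) • 1 := by
  ext b b'
  by_cases h : b = b' <;> simp [traceRight, Matrix.one_apply, h]

theorem posDef_smul_one [DecidableEq B] {c : ℝ} (hc : 0 < c) : ((c : ℂ) • (1 : Op B)).PosDef :=
  Matrix.PosDef.one.smul (by exact_mod_cast hc)

theorem traceRight_posSemidef {X : Op (B × A)} (hX : X.PosSemidef) :
    (traceRight X).PosSemidef := by
  have : traceRight X = ∑ a, X.submatrix (fun b => (b, a)) (fun b => (b, a)) := by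
    ext b b'
    simp [traceRight, Matrix.sum_apply]
  rw [this]
  exact Matrix.posSemidef_sum _ fun a _ => hX.submatrix _

theorem traceRight_add (X Y : Op (B × A)) : traceRight (X + Y) = traceRight X + traceRight Y := by
  ext b b'
  simp [traceRight, Finset.sum_add_distrib]

theorem traceRight_smul (c : ℂ) (X : Op (B × A)) : traceRight (c • X) = c • traceRight X := by
  ext b b'
  simp [traceRight, Finset.mul_sum]

theorem trace_choi [DecidableEq A] {N : SuperOp A B} (hN : IsChannel N) :
    (choi N).trace = Fintype.card A := by
  have : (choi N).trace = ∑ a, (N (Matrix.single a a 1)).trace := by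
    simp only [Matrix.trace, Matrix.diag, Fintype.sum_prod_type, choi, Matrix.of_apply]
    exact Finset.sum_comm
  rw [this]
  simp [hN.2]

/-- Alice uses `μ Y` for the good outcome and `X` for the bad one. Adding `δ • 1` to both keeps the
marginals equal and makes them invertible. -/
theorem exists_isPEA_of_not_dominated [DecidableEq A] {d : ℕ} (hd : 0 < d) {N : SuperOp A B}
    (hN : IsChannel N) {ε : ℝ} (hε0 : 0 < ε) (hε1 : ε < 1) {μ : ℝ} (hμ : 0 < μ)
    (hdμ : (d : ℝ) ^ 2 - 1 ≤ ε / (1 - ε) * μ)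
    (h : ¬ ∃ σ : Op B, σ.IsHermitian ∧ (choi N - σ ⊗ₖ (1 : Op A)).PosSemidef ∧
      ((μ : ℂ) • (σ ⊗ₖ (1 : Op A)) - choi N).PosSemidef) :
    ∃ Θ : Supermap A B (Fin d) (Fin d), IsPEA Θ ∧ quantumError (Θ N) ≤ ε := by
  classical
  have hJ := hN.1.choi_posSemidef
  obtain ⟨X, Y, hX, hY, hXY, hlt⟩ := exists_dual hJ hμ h
  have hcard : (0 : ℝ) < Fintype.card A := by exact_mod_cast Fintype.card_pos
  set x := (pairing X (choi N)).re with hx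
  set y := (pairing Y (choi N)).re with hy
  have hx0 : 0 ≤ x := (Complex.le_def.1 (pairing_nonneg hX hJ)).1
  set a : ℝ := (Fintype.card A : ℝ) with ha
  -- Since `Tr J = a`, this choice uses up the strict gap exactly: the bad weight rises from `x` to
  -- `y`, and the good one is at least `μ y`.
  set δ : ℝ := (y - x) / a with hδ
  have hδ0 : 0 < δ := div_pos (sub_pos.2 hlt) hcard
  have hδa : δ * a = y - x := div_mul_cancel₀ _ hcard.ne'
  have htr : (choi N).trace = (a : ℂ) := by rw [trace_choi hN, ha]; simp
  have hone : ((δ : ℂ) • (1 : Op (B × A))).PosSemidef :=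
    PosSemidef.real_smul Matrix.PosSemidef.one hδ0.le
  have p1 : (pairing ((μ : ℂ) • Y + (δ : ℂ) • 1) (choi N)).re = μ * y + δ * a := by
    rw [pairing_add_left, pairing_smul_left, pairing_smul_left, pairing_one_left, htr,
      Complex.add_re, Complex.re_ofReal_mul, Complex.re_ofReal_mul, Complex.ofReal_re]
  have p2 : (pairing (X + (δ : ℂ) • 1) (choi N)).re = x + δ * a := by
    rw [pairing_add_left, pairing_smul_left, pairing_one_left, htr,
      Complex.add_re, Complex.re_ofReal_mul, Complex.ofReal_re]
  refine exists_isPEA_quantumError_le hd hN.1 ((PosSemidef.real_smul hY hμ.le).add hone)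
    (hX.add hone) ?_ ?_ hε1 ?_ ?_
  · rw [traceRight_add, traceRight_add, traceRight_smul, hXY]
  · rw [traceRight_add, traceRight_smul, traceRight_one, smul_smul]
    refine Matrix.PosDef.posSemidef_add (traceRight_posSemidef hX) ?_
    have := posDef_smul_one (B := B) (mul_pos hδ0 hcard)
    rw [ha] at this
    push_cast at this
    exact this
  · rw [p1, hδa]
    have := mul_nonneg hμ.le (hx0.trans hlt.le)
    linarith
  · rw [p1, p2, hδa, add_sub_cancel]
    have hy0 : 0 ≤ y := hx0.trans hlt.le
    have hκ : 0 ≤ ε / (1 - ε) := div_nonneg hε0.le (by linarith)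
    calc ((d : ℝ) ^ 2 - 1) * y ≤ ε / (1 - ε) * μ * y := mul_le_mul_of_nonneg_right hdμ hy0
      _ = ε / (1 - ε) * (μ * y) := by ring
      _ ≤ ε / (1 - ε) * (μ * y + (y - x)) :=
        mul_le_mul_of_nonneg_left (by linarith) hκ

theorem exists_isPEA_one (N : SuperOp A B) (hN : IsChannel N) {ε : ℝ} (hε0 : 0 < ε)
    (hε1 : ε < 1) : ∃ Θ : Supermap A B (Fin 1) (Fin 1), IsPEA Θ ∧ quantumError (Θ N) ≤ ε := by
  classical
  have hcard : (0 : ℝ) < Fintype.card A := by exact_mod_cast Fintype.card_pos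
  have hx : (pairing 1 (choi N)).re = Fintype.card A := by
    rw [pairing_one_left, trace_choi hN]; simp
  refine exists_isPEA_quantumError_le (X := 1) (Y := 1) one_pos hN.1 Matrix.PosSemidef.one
    Matrix.PosSemidef.one rfl ?_ hε1 (hx ▸ hcard) ?_
  · rw [traceRight_one]
    have := posDef_smul_one (B := B) hcard
    push_cast at this
    exact this
  · have hκ : 0 ≤ ε / (1 - ε) := div_nonneg hε0.le (by linarith)
    rw [hx]
    norm_num
    positivity

end Achievability

/-! ### Logarithms, and the projective mutual information as an optimal sandwich ratio. -/

section Logarithm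

theorem log_two_pos_ereal : (0 : EReal) < ((Real.log 2 : ℝ) : EReal) := by
  exact_mod_cast Real.log_pos one_lt_two

theorem twoPow_log2 (x : ℝ≥0∞) : twoPow (log2 x) = x := by
  rw [twoPow, log2, EReal.div_mul_cancel (EReal.coe_ne_bot _) (EReal.coe_ne_top _)
    log_two_pos_ereal.ne', ENNReal.exp_log]

theorem twoPow_lt_iff {x : EReal} {y : ℝ≥0∞} : twoPow x < y ↔ x < log2 y := by
  rw [log2, EReal.lt_div_iff log_two_pos_ereal (EReal.coe_ne_top _), twoPow,
    ← ENNReal.log_lt_log_iff, EReal.log_exp]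

theorem le_twoPow_iff {x : EReal} {y : ℝ≥0∞} : y ≤ twoPow x ↔ log2 y ≤ x :=
  le_iff_le_iff_lt_iff_lt.2 twoPow_lt_iff

theorem twoPow_le_iff {x : EReal} {y : ℝ≥0∞} : twoPow x ≤ y ↔ x ≤ log2 y := by
  rw [log2, EReal.le_div_iff_mul_le log_two_pos_ereal (EReal.coe_ne_top _), twoPow,
    ← ENNReal.log_le_log_iff, EReal.log_exp]

theorem log2_mono : Monotone log2 := fun x y h => by
  rw [← le_twoPow_iff, twoPow_log2]; exact h

theorem twoPow_mono : Monotone twoPow := fun x y h => by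
  by_contra! hlt
  exact absurd (h.trans_lt (twoPow_lt_iff.1 hlt)) (not_lt.2 (le_twoPow_iff.1 le_rfl))

theorem twoPow_add (x y : EReal) : twoPow (x + y) = twoPow x * twoPow y := by
  rw [twoPow, EReal.right_distrib_of_nonneg_of_ne_top log_two_pos_ereal.le (EReal.coe_ne_top _),
    EReal.exp_add]
  rfl

end Logarithm

section Information

variable {A B n : Type*} [Fintype A] [Fintype B] [Fintype n]

theorem twoPow_dMax (ρ σ : Op n) :
    twoPow (dMax ρ σ) = ⨅ (l : ℝ) (_ : ((l : ℂ) • σ - ρ).PosSemidef), ENNReal.ofReal l :=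
  twoPow_log2 _

theorem twoPow_dMax_le {ρ σ : Op n} {l : ℝ} (h : ((l : ℂ) • σ - ρ).PosSemidef) :
    twoPow (dMax ρ σ) ≤ ENNReal.ofReal l := by
  rw [twoPow_dMax]; exact iInf₂_le l h

theorem one_le_of_posSemidef {ρ σ : Op n} (hρ : ρ.trace = 1) (hσ : σ.trace = 1) {l : ℝ}
    (h : ((l : ℂ) • σ - ρ).PosSemidef) : 1 ≤ l := by
  have := trace_re_nonneg h
  rw [Matrix.trace_sub, Matrix.trace_smul, hρ, hσ] at this
  simpa using this

theorem one_le_twoPow_dMax {ρ σ : Op n} (hρ : ρ.trace = 1) (hσ : σ.trace = 1) :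
    1 ≤ twoPow (dMax ρ σ) := by
  rw [twoPow_dMax]
  refine le_iInf₂ fun l h => ?_
  rw [← ENNReal.ofReal_one]
  exact ENNReal.ofReal_le_ofReal (one_le_of_posSemidef hρ hσ h)

/-- Comparing traces shows that both infima are at least `1`, so the strict bound on their product
can be divided. Near-optimal `l₁` and `l₂` are then picked one after the other, and neither infimum
has to be attained. -/
theorem exists_of_dOmega_lt {ρ σ : Op n} (hρ : ρ.trace = 1) (hσ : σ.trace = 1) {l : ℝ}
    (h : dOmega ρ σ < log2 (ENNReal.ofReal l)) :
    ∃ l₁ l₂ : ℝ, 1 ≤ l₁ ∧ 1 ≤ l₂ ∧ l₁ * l₂ < l ∧ ((l₁ : ℂ) • σ - ρ).PosSemidef ∧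
      ((l₂ : ℂ) • ρ - σ).PosSemidef := by
  rw [← twoPow_lt_iff, dOmega, twoPow_add] at h
  have h1 := one_le_twoPow_dMax hρ hσ
  have h2 := one_le_twoPow_dMax hσ hρ
  set u₁ := twoPow (dMax ρ σ) with hu₁
  set u₂ := twoPow (dMax σ ρ) with hu₂
  have hu₁0 : u₁ ≠ 0 := (zero_lt_one.trans_le h1).ne'
  have hu₂0 : u₂ ≠ 0 := (zero_lt_one.trans_le h2).ne'
  have hu₂t : u₂ ≠ ⊤ := fun ht => by
    rw [ht, ENNReal.mul_top hu₁0] at h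
    exact not_top_lt h
  have h3 : u₁ < ENNReal.ofReal l / u₂ :=
    (ENNReal.lt_div_iff_mul_lt (Or.inl hu₂0) (Or.inl hu₂t)).2 h
  rw [hu₁, twoPow_dMax] at h3
  simp only [iInf_lt_iff] at h3
  obtain ⟨l₁, hl₁, h4⟩ := h3
  have hl₁1 := one_le_of_posSemidef hρ hσ hl₁
  have h5 : u₂ < ENNReal.ofReal l / ENNReal.ofReal l₁ := by
    rw [ENNReal.lt_div_iff_mul_lt (Or.inl (by simp; linarith)) (Or.inl ENNReal.ofReal_ne_top),
      mul_comm]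
    exact (ENNReal.lt_div_iff_mul_lt (Or.inl hu₂0) (Or.inl hu₂t)).1 h4
  rw [hu₂, twoPow_dMax] at h5
  simp only [iInf_lt_iff] at h5
  obtain ⟨l₂, hl₂, h6⟩ := h5
  have hl₂1 := one_le_of_posSemidef hσ hρ hl₂
  rw [ENNReal.lt_div_iff_mul_lt (Or.inl (by simp; linarith)) (Or.inl ENNReal.ofReal_ne_top),
    ← ENNReal.ofReal_mul (by linarith), ENNReal.ofReal_lt_ofReal_iff_of_nonneg
      (by positivity), mul_comm] at h6
  exact ⟨l₁, l₂, hl₁1, hl₂1, h6, hl₁, hl₂⟩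

theorem IsChannel.traceRight_ampl {K : Type*} {N : SuperOp A B} (hN : IsChannel N)
    (X : Op (K × A)) : traceRight (Postselected.ampl K N X) = traceRight X := by
  ext k l
  exact hN.2 (block k l X)

theorem exists_dominating [Nonempty A] {N : SuperOp A B} (hN : IsChannel N)
    {l : ℝ} (h : channelProjMutualInfo N < log2 (ENNReal.ofReal l)) :
    ∃ (σ : Op B) (l₁ l₂ : ℝ), IsState σ ∧ 0 ≤ l₂ ∧ l₁ * l₂ < l ∧
      IsCP ((l₁ : ℂ) • replacer A σ - N) ∧ IsCP ((l₂ : ℂ) • N - replacer A σ) := by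
  classical
  let e : Fin (Fintype.card A) ≃ A := (Fintype.equivFin A).symm
  have h1 : projMutualInfo (ampl (Fin (Fintype.card A)) N (maxEnt e)) <
      log2 (ENNReal.ofReal l) :=
    lt_of_le_of_lt (le_iSup_of_le (Fintype.card A) (le_iSup₂_of_le
      (f := fun ρ (_ : IsState ρ) => projMutualInfo (ampl (Fin (Fintype.card A)) N ρ)) (maxEnt e)
      (isState_maxEnt e) le_rfl)) h
  simp only [projMutualInfo, iInf_lt_iff] at h1
  obtain ⟨σ, hσ, h2⟩ := h1
  rw [hN.traceRight_ampl, ← ampl_replacer] at h2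
  have ht1 : (ampl (Fin (Fintype.card A)) N (maxEnt e)).trace = 1 := by
    rw [hN.ampl.2, maxEnt_trace]
  have ht2 : (ampl (Fin (Fintype.card A)) (replacer A σ) (maxEnt e)).trace = 1 := by
    have : (traceRight (maxEnt e)).trace = 1 := by
      rw [← maxEnt_trace e, trace_eq_sum_block]; rfl
    rw [ampl_replacer, Matrix.trace_kronecker, hσ.2, this, one_mul]
  obtain ⟨l₁, l₂, -, hl₂, hl, hp1, hp2⟩ := exists_of_dOmega_lt ht1 ht2 h2
  exact ⟨σ, l₁, l₂, hσ, by linarith, hl, isCP_of_maxEnt e hp1, isCP_of_maxEnt e hp2⟩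

/-- One `σ`, normalized by its trace `t`, serves all inputs: the two max-relative entropies
contribute at most `μ t` and `t⁻¹`, and `t` cancels. -/
theorem channelProjMutualInfo_le [Nonempty A] [DecidableEq A] {N : SuperOp A B}
    (hN : IsChannel N) {μ : ℝ} (hμ : 0 < μ)
    (h : ∃ σ : Op B, σ.IsHermitian ∧ (choi N - σ ⊗ₖ (1 : Op A)).PosSemidef ∧
      ((μ : ℂ) • (σ ⊗ₖ (1 : Op A)) - choi N).PosSemidef) :
    channelProjMutualInfo N ≤ log2 (ENNReal.ofReal μ) := by
  obtain ⟨σ, -, h1, h2⟩ := h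
  rw [← choi_replacer] at h1 h2
  have c1 : IsCP (N - replacer A σ) := isCP_of_choi h1
  have c2 : IsCP ((μ : ℂ) • replacer A σ - N) := isCP_of_choi h2
  obtain ⟨a, ha⟩ := exists_isState A
  -- Positivity comes from the sandwich: `μ • replacer A σ` is the sum of the completely positive
  -- maps `μ • replacer A σ - N` and `N`.
  have hσ : σ.PosSemidef := by
    have h3 := (c2.add hN.1).posSemidef ha.1
    rw [sub_add_cancel, LinearMap.smul_apply, replacer_apply, ha.2, one_smul] at h3
    have := PosSemidef.real_smul h3 (inv_nonneg.2 hμ.le)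
    rwa [smul_smul, ← Complex.ofReal_mul, inv_mul_cancel₀ hμ.ne', Complex.ofReal_one,
      one_smul] at this
  set t : ℝ := σ.trace.re with ht
  have htσ : σ.trace = (t : ℂ) := trace_eq_ofReal hσ
  have htpos : 0 < t := by
    have := trace_re_nonneg (c2.posSemidef ha.1)
    rw [LinearMap.sub_apply, LinearMap.smul_apply, replacer_apply, ha.2, one_smul,
      Matrix.trace_sub, hN.2, ha.2, Matrix.trace_smul, htσ] at this
    simp at this
    by_contra! hneg
    nlinarith
  set σ' : Op B := ((t⁻¹ : ℝ) : ℂ) • σ with hσ'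
  have hσs : σ = (t : ℂ) • σ' := by
    rw [hσ', smul_smul, ← Complex.ofReal_mul, mul_inv_cancel₀ htpos.ne', Complex.ofReal_one,
      one_smul]
  have hst : IsState σ' := by
    refine ⟨PosSemidef.real_smul hσ (inv_nonneg.2 htpos.le), ?_⟩
    rw [hσ', Matrix.trace_smul, htσ, smul_eq_mul, ← Complex.ofReal_mul,
      inv_mul_cancel₀ htpos.ne', Complex.ofReal_one]
  refine iSup_le fun r => iSup₂_le fun ρ hρ => ?_
  refine (iInf₂_le σ' hst).trans ?_
  rw [hN.traceRight_ampl, dOmega]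
  have hk : traceRight ρ ⊗ₖ σ = (t : ℂ) • (traceRight ρ ⊗ₖ σ') := by
    rw [hσs, Matrix.kronecker_smul]
  have e1 : twoPow (dMax (ampl (Fin r) N ρ) (traceRight ρ ⊗ₖ σ')) ≤ ENNReal.ofReal (μ * t) := by
    apply twoPow_dMax_le
    have := c2.ampl_posSemidef (K := Fin r) hρ.1
    have h3 : ampl (Fin r) ((μ : ℂ) • replacer A σ - N) ρ =
        (μ : ℂ) • (traceRight ρ ⊗ₖ σ) - ampl (Fin r) N ρ := by
      rw [← ampl_replacer]; rfl
    rw [h3, hk, smul_smul, ← Complex.ofReal_mul] at this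
    exact this
  have e2 : twoPow (dMax (traceRight ρ ⊗ₖ σ') (ampl (Fin r) N ρ)) ≤ ENNReal.ofReal t⁻¹ := by
    apply twoPow_dMax_le
    have := PosSemidef.real_smul (c1.ampl_posSemidef (K := Fin r) hρ.1) (inv_nonneg.2 htpos.le)
    have h3 : ampl (Fin r) (N - replacer A σ) ρ =
        ampl (Fin r) N ρ - traceRight ρ ⊗ₖ σ := by
      rw [← ampl_replacer]; rfl
    rw [h3, hk, smul_sub, smul_smul, ← Complex.ofReal_mul, inv_mul_cancel₀ htpos.ne',
      Complex.ofReal_one, one_smul] at this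
    exact this
  have e3 := mul_le_mul' e1 e2
  rw [← twoPow_add, ← ENNReal.ofReal_mul (by positivity), mul_assoc, mul_inv_cancel₀ htpos.ne',
    mul_one] at e3
  exact twoPow_le_iff.1 e3

end Information

/-! ### Capacity bounds. -/

section Capacity

variable {A B : Type*} [Fintype A] [Fintype B] [Nonempty A] [Nonempty B]

theorem lt_capacityRoot_iff (ε : ℝ) (N : SuperOp A B) (d : ℕ) :
    (d : ℝ≥0∞) < capacityRoot ε N ↔
      ENNReal.ofReal ((d : ℝ) ^ 2) <
        ENNReal.ofReal (ε / (1 - ε)) * twoPow (channelProjMutualInfo N) + 1 := by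
  rw [capacityRoot, one_div, ENNReal.lt_rpow_inv_iff two_pos, ENNReal.ofReal_pow (by positivity),
    ENNReal.ofReal_natCast]
  norm_cast

theorem le_capacityRoot_iff (ε : ℝ) (N : SuperOp A B) (d : ℕ) :
    (d : ℝ≥0∞) ≤ capacityRoot ε N ↔
      ENNReal.ofReal ((d : ℝ) ^ 2) ≤
        ENNReal.ofReal (ε / (1 - ε)) * twoPow (channelProjMutualInfo N) + 1 := by
  rw [capacityRoot, one_div, ENNReal.le_rpow_inv_iff two_pos, ENNReal.ofReal_pow (by positivity),
    ENNReal.ofReal_natCast]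
  norm_cast

theorem log2_le_qPEA {N : SuperOp A B} (hN : IsChannel N) {ε : ℝ} (hε0 : 0 < ε) (hε1 : ε < 1)
    {d : ℕ} (hd : 0 < d) (h : (d : ℝ≥0∞) < capacityRoot ε N) : log2 (d : ℝ≥0∞) ≤ qPEA ε N := by
  classical
  have key : ∃ Θ : Supermap A B (Fin d) (Fin d), IsPEA Θ ∧ quantumError (Θ N) ≤ ε := by
    -- For `d = 1` the ratio `μ = (d² - 1) / κ` would be `0`, outside the reach of the duality
    -- argument.
    rcases eq_or_lt_of_le (Nat.succ_le_of_lt hd) with h1 | h1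
    · obtain rfl : d = 1 := h1.symm
      exact exists_isPEA_one N hN hε0 hε1
    · have hκ : 0 < ε / (1 - ε) := div_pos hε0 (by linarith)
      have hd2 : (1 : ℝ) < d := by exact_mod_cast h1
      have hD : 0 < (d : ℝ) ^ 2 - 1 := by nlinarith
      have hμ : 0 < ((d : ℝ) ^ 2 - 1) / (ε / (1 - ε)) := div_pos hD hκ
      have hκμ : ε / (1 - ε) * (((d : ℝ) ^ 2 - 1) / (ε / (1 - ε))) = (d : ℝ) ^ 2 - 1 :=
        mul_div_cancel₀ _ hκ.ne'
      refine exists_isPEA_of_not_dominated hd hN hε0 hε1 hμ hκμ.ge fun hdom => ?_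
      have h2 := twoPow_mono (channelProjMutualInfo_le hN hμ hdom)
      rw [twoPow_log2] at h2
      rw [lt_capacityRoot_iff] at h
      have h3 : ENNReal.ofReal (ε / (1 - ε)) * twoPow (channelProjMutualInfo N) + 1 ≤
          ENNReal.ofReal ((d : ℝ) ^ 2) := by
        refine (add_le_add_left (mul_le_mul_right h2 _) 1).trans_eq ?_
        rw [← ENNReal.ofReal_mul hκ.le, hκμ, ← ENNReal.ofReal_one,
          ← ENNReal.ofReal_add hD.le zero_le_one, sub_add_cancel]
      exact absurd h (not_lt.2 h3)
  obtain ⟨Θ, hΘ, herr⟩ := key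
  exact le_iSup₂_of_le d hd (le_iSup₂_of_le Θ hΘ (le_iSup_of_le herr le_rfl))

theorem le_capacityRoot [DecidableEq B] {N : SuperOp A B} (hN : IsChannel N) {ε : ℝ}
    (hε0 : 0 < ε) (hε1 : ε < 1) {d : ℕ} (hd : 0 < d) {Θ : Supermap A B (Fin d) (Fin d)}
    (hΘ : IsPNA Θ) (herr : quantumError (Θ N) ≤ ε) : (d : ℝ≥0∞) ≤ capacityRoot ε N := by
  rw [le_capacityRoot_iff]
  have hκ : 0 < ε / (1 - ε) := div_pos hε0 (by linarith)
  by_cases htop : twoPow (channelProjMutualInfo N) = ⊤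
  · rw [htop, ENNReal.mul_top (by simpa using hκ)]
    simp
  set W := (twoPow (channelProjMutualInfo N)).toReal with hW
  have hWof : twoPow (channelProjMutualInfo N) = ENNReal.ofReal W :=
    (ENNReal.ofReal_toReal htop).symm
  have hW0 : 0 ≤ W := ENNReal.toReal_nonneg
  -- The optimal ratio is approached from above, by every `l > W`.
  have hle : ((d : ℝ) ^ 2 - 1) / (ε / (1 - ε)) ≤ W := by
    refine le_of_forall_gt_imp_ge_of_dense fun l hl => ?_
    have hlt : channelProjMutualInfo N < log2 (ENNReal.ofReal l) := by
      rw [← twoPow_lt_iff, hWof]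
      exact (ENNReal.ofReal_lt_ofReal_iff_of_nonneg hW0).2 hl
    obtain ⟨σ, l₁, l₂, hσ, hl₂, hll, h₁, h₂⟩ := exists_dominating hN hlt
    rw [div_le_iff₀ hκ, mul_comm]
    exact (sq_sub_one_le hd hΘ hN.1 hσ hl₂ h₁ h₂ hε0 hε1 herr).trans
      (mul_le_mul_of_nonneg_left hll.le hκ.le)
  rw [div_le_iff₀ hκ] at hle
  rw [hWof, ← ENNReal.ofReal_mul hκ.le, ← ENNReal.ofReal_one,
    ← ENNReal.ofReal_add (by positivity) zero_le_one]
  exact ENNReal.ofReal_le_ofReal (by linarith)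

theorem qPEA_le_qPNA [DecidableEq B] (ε : ℝ) (N : SuperOp A B) : qPEA ε N ≤ qPNA ε N := by
  refine iSup₂_le fun d hd => iSup₂_le fun Θ hΘ => iSup_le fun herr => ?_
  have : Nonempty (Fin d) := ⟨⟨0, hd⟩⟩
  exact le_iSup₂_of_le d hd (le_iSup₂_of_le Θ (IsPEA.isPNA hΘ) (le_iSup_of_le herr le_rfl))

end Capacity

end Postselected

theorem theorem1 {A B : Type*} [Fintype A] [Fintype B] [DecidableEq B] [Nonempty A] [Nonempty B]
    (N : Postselected.SuperOp A B) (hN : Postselected.IsChannel N)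
    (ε : ℝ) (hε0 : 0 < ε) (hε1 : ε < 1) :
    Postselected.log2 (ENat.toENNReal (ENat.ceil (Postselected.capacityRoot ε N - 1)))
        ≤ Postselected.qPEA ε N ∧
      Postselected.qPEA ε N ≤ Postselected.qPNA ε N ∧
      Postselected.qPNA ε N
        ≤ Postselected.log2 (ENat.toENNReal (ENat.floor (Postselected.capacityRoot ε N))) := by
  open Postselected in
  refine ⟨?_, qPEA_le_qPNA ε N, ?_⟩
  · rw [← le_twoPow_iff]
    -- A positive integer is at most `⌈x - 1⌉` exactly when it is strictly less than `x`, which is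
    -- the strictness that achievability requires.
    have hlow : ∀ d : ℕ, (d : ℕ∞) < ENat.ceil (capacityRoot ε N - 1) →
        ((d + 1 : ℕ) : ℝ≥0∞) ≤ twoPow (qPEA ε N) := by
      intro d hd
      rw [ENat.lt_ceil, lt_tsub_iff_right] at hd
      rw [le_twoPow_iff]
      exact log2_le_qPEA hN hε0 hε1 d.succ_pos (by push_cast; simpa using hd)
    generalize ENat.ceil (capacityRoot ε N - 1) = c at hlow
    induction c with
    | top =>
      refine le_of_eq (ENNReal.eq_top_of_forall_nnreal_le fun r => ?_).symm
      obtain ⟨n, hn⟩ := exists_nat_ge r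
      refine le_trans ?_ (hlow n (ENat.natCast_lt_top n))
      push_cast
      exact le_add_right (by exact_mod_cast hn)
    | coe n =>
      cases n with
      | zero => simp
      | succ n => exact_mod_cast hlow n (by exact_mod_cast n.lt_succ_self)
  · refine iSup₂_le fun d hd => iSup₂_le fun Θ hΘ => iSup_le fun herr => log2_mono ?_
    have h := le_capacityRoot hN hε0 hε1 hd hΘ herr
    have h2 : (d : ℕ∞) ≤ ENat.floor (capacityRoot ε N) := ENat.le_floor.2 (by simpa using h)
    exact_mod_cast ENat.toENNReal_le.2 h2
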